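/- All Lie groups are real. A Lie group $G$ with Lie algebra $\mathfrak g$ is called non-unimodular if $\operatorname{trace}(\operatorname{ad}_X)\neq 0$ for some $X\in\mathfrak g$ (for a connected $G$ this means that the left Haar measure is not right-invariant). The Ricci operator of a Riemannian metric $\rho$ is the field of symmetric operators $\operatorname{Ric}$ on the tangent spaces with $\rho(\operatorname{Ric} Y, Z)=\operatorname{trace}\bigl(X\mapsto R(X,Y)Z\bigr)$, where $R(X,Y)Z=\nabla_X\nabla_YZ-\nabla_Y\nabla_XZ-\nabla_{[X,Y]}Z$ and $\nabla$ is the Levi-Civita connection of $\rho$. The signature of a symmetric operator on a $4$-dimensional Euclidean space with eigenvalues $\lambda_1\le\lambda_2\le\lambda_3\le\lambda_4$ (listed with multiplicity) is $(\operatorname{sgn}\lambda_1,\operatorname{sgn}\lambda_2,\operatorname{sgn}\lambda_3,\operatorname{sgn}\lambda_4)$. Corollary 3. (1) For every $4$-dimensional non-unimodular Lie group $G$ and every left-invariant Riemannian metric $\rho$ on $G$, the Ricci operator of $(G,\rho)$ has, at every point, at least two negative eigenvalues, counted with multiplicity. (2) For each of the six signatures $(-,-,-,-)$, $(-,-,-,0)$,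 $(-,-,-,+)$, $(-,-,0,0)$, $(-,-,0,+)$ and $(-,-,+,+)$ there are a connected $4$-dimensional non-unimodular Lie group $G$ and a left-invariant Riemannian metric $\rho$ on $G$ such that the Ricci operator of $(G,\rho)$ has this signature at every point. -/

import Mathlib

open scoped Manifold ContDiff

noncomputable section

namespace LeftInvariantRicci

variable {E : Type*} [NormedAddCommGroup E] [NormedSpace ℝ E] [FiniteDimensional ℝ E]
  {H : Type*} [TopologicalSpace H] (I : ModelWithCorners ℝ E H)
  {G : Type*} [TopologicalSpace G] [ChartedSpace H G] [Group G] [LieGroup I ∞ G]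

/-- A smooth real Lie group has the smoothness needed for the Lie algebra structure on its tangent
space at the identity. -/
instance lieGroup_minSmoothness : LieGroup I (minSmoothness ℝ 3) G :=
  LieGroup.of_le (n := ∞) (by simp [minSmoothness_of_isRCLikeNormedField]; norm_cast)

variable (G) in
/-- A Lie group is called unimodular here if all operators `ad x` on its Lie algebra have trace
zero. For connected groups this is equivalent to the Haar measure being two-sided invariant. -/
def IsUnimodular : Prop :=
  ∀ x : GroupLieAlgebra I G, LinearMap.trace ℝ _ (LieAlgebra.ad ℝ (GroupLieAlgebra I G) x) = 0

variable (G) in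
/-- Smooth Riemannian metrics on `G`. -/
abbrev Metric : Type _ :=
  Bundle.ContMDiffRiemannianMetric I ∞ E (fun p : G ↦ TangentSpace I p)

variable (G) in
/-- Affine connections on `G`; `cov Y p (X p)` is `(∇_X Y)(p)`. -/
abbrev Connection : Type _ :=
  CovariantDerivative I E (fun p : G ↦ TangentSpace I p)

variable {I}

/-- All left translations are isometries. -/
def IsLeftInvariant (g : Metric I G) : Prop :=
  ∀ (a p : G) (v w : TangentSpace I p),
    g.inner (a * p) (mfderiv I I (a * ·) p v) (mfderiv I I (a * ·) p w) = g.inner p v w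

/-- The connection is torsion-free and `X ⟨Y, Z⟩ = ⟨∇_X Y, Z⟩ + ⟨Y, ∇_X Z⟩`. -/
def IsLeviCivita (g : Metric I G) (cov : Connection I G) : Prop :=
  cov.torsion = 0 ∧
  ∀ (p : G) (v : TangentSpace I p) (Y Z : (q : G) → TangentSpace I q),
    MDiffAt (T% Y) p → MDiffAt (T% Z) p →
      mfderiv I 𝓘(ℝ, ℝ) (fun q ↦ g.inner q (Y q) (Z q)) p v =
        g.inner p (cov Y p v) (Z p) + g.inner p (Y p) (cov Z p v)

/-- `R(X, Y) Z = ∇_X ∇_Y Z - ∇_Y ∇_X Z - ∇_[X, Y] Z`, for vector fields `X`, `Y`, `Z`. -/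
def curvature (cov : Connection I G) (X Y Z : (q : G) → TangentSpace I q) (p : G) :
    TangentSpace I p :=
  cov (fun q ↦ cov Z q (Y q)) p (X p) - cov (fun q ↦ cov Z q (X q)) p (Y p)
    - cov Z p (VectorField.mlieBracket I X Y p)

/-- The left-invariant vector field whose value at `p` is `v`. -/
def leftExtension (p : G) (v : TangentSpace I p) : (q : G) → TangentSpace I q :=
  mulInvariantVectorField (mfderiv I I (p⁻¹ * ·) p v : GroupLieAlgebra I G)

/-- `A` is the Ricci operator of `g` at `p`: with the Levi-Civita connection of `g`, one has
`⟨A y, z⟩ = Ric(y, z)` for all tangent vectors `y`, `z`, where `Ric(y, z)` is the trace of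
`x ↦ R(x, y) z`. The value at `p` of the curvature `R(X, Y) Z` depends only on the values of
`X`, `Y`, `Z` at `p`, so it is evaluated here on left-invariant vector fields. -/
def IsRicciOperator (g : Metric I G) (p : G)
    (A : TangentSpace I p →ₗ[ℝ] TangentSpace I p) : Prop :=
  ∃ cov : Connection I G, IsLeviCivita g cov ∧
    ∀ y z : TangentSpace I p, ∃ T : TangentSpace I p →ₗ[ℝ] TangentSpace I p,
      (∀ x : TangentSpace I p,
        T x = curvature cov (leftExtension p x) (leftExtension p y) (leftExtension p z) p) ∧
      g.inner p (A y) z = LinearMap.trace ℝ _ T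

/-- The Ricci operator of `g` at `p`, that is, the only operator satisfying `IsRicciOperator`. -/
def ricciOperator (g : Metric I G) (p : G) : TangentSpace I p →ₗ[ℝ] TangentSpace I p :=
  Classical.epsilon (IsRicciOperator g p)

/-- The real eigenvalues of an operator, with (algebraic) multiplicities. For a symmetric operator
on an `n`-dimensional Euclidean space these are `n` numbers, and the algebraic multiplicities are
the dimensions of the eigenspaces. -/
def eigenvalues {V : Type*} [AddCommGroup V] [Module ℝ V] [FiniteDimensional ℝ V]
    (A : V →ₗ[ℝ] V) : Multiset ℝ :=
  A.charpoly.roots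

/-- The list of the signs of the eigenvalues `λ₁ ≤ ⋯ ≤ λₙ`. -/
def signature {V : Type*} [AddCommGroup V] [Module ℝ V] [FiniteDimensional ℝ V]
    (A : V →ₗ[ℝ] V) : List SignType :=
  ((eigenvalues A).sort (· ≤ ·)).map SignType.sign

instance finiteDimensional_tangentSpace (p : G) : FiniteDimensional ℝ (TangentSpace I p) :=
  inferInstanceAs (FiniteDimensional ℝ E)

end LeftInvariantRicci

end

noncomputable section

namespace LeftInvariantRicci

section LieAlgebra

variable {ι : Type*} [Fintype ι]

/-- The Christoffel symbols of the Levi-Civita connection in an orthonormal left-invariant frame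
with structure constants `c`, where `[e i, e j] = ∑ k, c i j k • e k`. -/
def christoffel (c : ι → ι → ι → ℝ) (i j k : ι) : ℝ :=
  (c i j k - c j k i + c k i j) / 2

/-- The components of the Ricci form in an orthonormal left-invariant frame with structure
constants `c`. -/
def ricciMatrix (c : ι → ι → ι → ℝ) : Matrix ι ι ℝ := fun j k ↦
  ∑ i, ∑ m, (christoffel c j k m * christoffel c i m i - christoffel c i k m * christoffel c j m i
    - c i j m * christoffel c m k i)

variable {L : Type*} [LieRing L] [LieAlgebra ℝ L] (b : Module.Basis ι ℝ L)

/-- The structure constants of a Lie algebra with respect to a basis. -/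
def structureConstants (i j k : ι) : ℝ := b.repr ⁅b i, b j⁆ k

lemma structureConstants_skew (i j k : ι) :
    structureConstants b i j k = -structureConstants b j i k := by
  rw [structureConstants, ← lie_skew, map_neg, Finsupp.neg_apply, structureConstants]

/-- The Levi-Civita product on a Lie algebra for the metric for which the basis `b` is
orthonormal. -/
def nabla : L →ₗ[ℝ] L →ₗ[ℝ] L :=
  b.constr ℝ fun i ↦ b.constr ℝ fun j ↦ ∑ k, christoffel (structureConstants b) i j k • b k

lemma nabla_basis (i j : ι) :
    nabla b (b i) (b j) = ∑ k, christoffel (structureConstants b) i j k • b k := by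
  rw [nabla, Module.Basis.constr_basis, Module.Basis.constr_basis]

lemma repr_nabla_basis (i j k : ι) :
    b.repr (nabla b (b i) (b j)) k = christoffel (structureConstants b) i j k := by
  classical
  simp [nabla_basis, Finsupp.single_apply]

/-- The operator `x ↦ ∇ x (∇ y z) - ∇ y (∇ x z) - ∇ [x, y] z`. -/
def curvatureOperator (y z : L) : L →ₗ[ℝ] L :=
  (nabla b).flip (nabla b y z) - nabla b y ∘ₗ (nabla b).flip z
    + (nabla b).flip z ∘ₗ (LieAlgebra.ad ℝ L y : L →ₗ[ℝ] L)

lemma curvatureOperator_apply (x y z : L) :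
    curvatureOperator b y z x =
      nabla b x (nabla b y z) - nabla b y (nabla b x z) - nabla b ⁅x, y⁆ z := by
  simp only [curvatureOperator, LinearMap.add_apply, LinearMap.sub_apply, LinearMap.comp_apply,
    LinearMap.flip_apply, LieAlgebra.ad_apply]
  rw [← lie_skew x y, map_neg, LinearMap.neg_apply, sub_neg_eq_add]

/-- The Ricci form, as the trace of the curvature operator. -/
def ricciForm : L →ₗ[ℝ] L →ₗ[ℝ] ℝ :=
  LinearMap.mk₂ ℝ (fun y z ↦ LinearMap.trace ℝ L (curvatureOperator b y z))
    (fun y y' z ↦ by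
      rw [← map_add]; congr 1; ext x
      simp only [LinearMap.add_apply, curvatureOperator_apply, map_add, lie_add]; abel)
    (fun r y z ↦ by
      rw [← map_smul]; congr 1; ext x
      simp only [LinearMap.smul_apply, curvatureOperator_apply, map_smul, lie_smul, smul_sub])
    (fun y z z' ↦ by
      rw [← map_add]; congr 1; ext x
      simp only [LinearMap.add_apply, curvatureOperator_apply, map_add]; abel)
    (fun r y z ↦ by
      rw [← map_smul]; congr 1; ext x
      simp only [LinearMap.smul_apply, curvatureOperator_apply, map_smul, smul_sub])

lemma ricciForm_basis [DecidableEq ι] (j k : ι) :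
    ricciForm b (b j) (b k) = ricciMatrix (structureConstants b) j k := by
  have hlie (i j : ι) : ⁅b i, b j⁆ = ∑ m, structureConstants b i j m • b m :=
    (b.sum_repr _).symm
  rw [ricciForm, LinearMap.mk₂_apply, LinearMap.trace_eq_matrix_trace ℝ b, Matrix.trace]
  refine Finset.sum_congr rfl fun i _ ↦ ?_
  rw [Matrix.diag_apply, LinearMap.toMatrix_apply, curvatureOperator_apply, hlie, nabla_basis,
    nabla_basis]
  simp only [map_sum, map_smul, map_sub, LinearMap.sum_apply, LinearMap.smul_apply,
    Finsupp.sub_apply, Finsupp.finsetSum_apply, Finsupp.smul_apply, repr_nabla_basis, smul_eq_mul,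
    Finset.sum_sub_distrib]

/-- The Ricci operator on the Lie algebra, for the metric for which the basis `b` is
orthonormal. -/
def algRicciOperator [DecidableEq ι] : L →ₗ[ℝ] L :=
  Matrix.toLin b b (ricciMatrix (structureConstants b)).transpose

lemma charpoly_algRicciOperator [DecidableEq ι] [Module.Finite ℝ L] :
    (algRicciOperator b).charpoly = (ricciMatrix (structureConstants b)).charpoly := by
  rw [algRicciOperator, Matrix.charpoly_toLin, Matrix.charpoly_transpose]

lemma apply_algRicciOperator [DecidableEq ι] {h : L →ₗ[ℝ] L →ₗ[ℝ] ℝ}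
    (hb : ∀ i j, h (b i) (b j) = if i = j then 1 else 0) (y z : L) :
    h (algRicciOperator b y) z = ricciForm b y z := by
  have : h ∘ₗ algRicciOperator b = ricciForm b := by
    refine b.ext fun j ↦ b.ext fun k ↦ ?_
    simp [algRicciOperator, Matrix.toLin_self, hb, ricciForm_basis]
  exact LinearMap.congr_fun₂ this y z

end LieAlgebra

section Geometry

variable {E : Type*} [NormedAddCommGroup E] [NormedSpace ℝ E] [FiniteDimensional ℝ E]
  {H : Type*} [TopologicalSpace H] {I : ModelWithCorners ℝ E H}
  {G : Type*} [TopologicalSpace G] [ChartedSpace H G] [Group G] [LieGroup I ∞ G]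

lemma mdifferentiableAt_mul_left' (a p : G) : MDifferentiableAt I I (a * ·) p :=
  (contMDiff_mul_left (I := I) (n := ∞)).contMDiffAt.mdifferentiableAt (by simp)

lemma mfderiv_apply_congr_point (f : G → G) {p q : G} (h : p = q) (v : E) :
    (mfderiv I I f p : E →L[ℝ] E) v = (mfderiv I I f q : E →L[ℝ] E) v := by
  subst h; rfl

lemma mfderiv_inv_mul_mulInvariantVectorField (p : G) (v : GroupLieAlgebra I G) :
    (mfderiv I I (p⁻¹ * ·) p (mulInvariantVectorField v p) : E) = (v : E) := by
  have h : ((p⁻¹ * ·) ∘ (p * ·) : G → G) = id := by ext; simp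
  have h2 := mfderiv_comp (I := I) (I' := I) (I'' := I) (1 : G) (g := (p⁻¹ * ·)) (f := (p * ·))
    (mdifferentiableAt_mul_left' _ _) (mdifferentiableAt_mul_left' _ _)
  rw [h, mfderiv_id] at h2
  have h3 : (v : E) = (mfderiv I I (p⁻¹ * ·) (p * 1) : E →L[ℝ] E)
      (mulInvariantVectorField v p) := DFunLike.congr_fun h2 v
  exact (mfderiv_apply_congr_point _ (mul_one p) _).symm.trans h3.symm

lemma mulInvariantVectorField_mfderiv_inv_mul (p : G) (v : TangentSpace I p) :
    mulInvariantVectorField (mfderiv I I (p⁻¹ * ·) p v : GroupLieAlgebra I G) p = v := by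
  have h : ((p * ·) ∘ (p⁻¹ * ·) : G → G) = id := by ext; simp
  have h2 := mfderiv_comp (I := I) (I' := I) (I'' := I) (p : G) (g := (p * ·)) (f := (p⁻¹ * ·))
    (mdifferentiableAt_mul_left' _ _) (mdifferentiableAt_mul_left' _ _)
  rw [h, mfderiv_id] at h2
  have h3 : (v : E) = (mfderiv I I (p * ·) (p⁻¹ * p) : E →L[ℝ] E)
      (mfderiv I I (p⁻¹ * ·) p v) := DFunLike.congr_fun h2 v
  exact (mfderiv_apply_congr_point _ (inv_mul_cancel p) _).symm.trans h3.symm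

/-- The derivative at the identity of the left translation by `p`. -/
def leftEquiv (p : G) : GroupLieAlgebra I G ≃ₗ[ℝ] TangentSpace I p where
  toFun v := mulInvariantVectorField v p
  map_add' v w := congr_fun (mulInvariantVectorField_add v w) p
  map_smul' r v := congr_fun (mulInvariantVectorField_smul r v) p
  invFun v := (mfderiv I I (p⁻¹ * ·) p v : E)
  left_inv v := mfderiv_inv_mul_mulInvariantVectorField p v
  right_inv v := mulInvariantVectorField_mfderiv_inv_mul p v

lemma leftEquiv_apply (p : G) (v : GroupLieAlgebra I G) :
    leftEquiv p v = mulInvariantVectorField v p := rfl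

lemma leftExtension_eq (p : G) (v : TangentSpace I p) :
    leftExtension p v = mulInvariantVectorField ((leftEquiv p).symm v) := rfl

lemma mlieBracket_mulInvariantVectorField (v w : GroupLieAlgebra I G) (p : G) :
    VectorField.mlieBracket I (mulInvariantVectorField v) (mulInvariantVectorField w) p =
      leftEquiv p ⁅v, w⁆ :=
  congr_fun (mulInvariantVector_mlieBracket v w).symm p

variable {g : Metric I G}

lemma IsLeftInvariant.inner_leftEquiv (hg : IsLeftInvariant g) (p : G)
    (v w : GroupLieAlgebra I G) :
    g.inner p (leftEquiv p v) (leftEquiv p w) = g.inner 1 v w := by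
  have key (q : G) (hq : q = p) (x y : E) :
    (g.inner q : E →L[ℝ] E →L[ℝ] ℝ) x y = (g.inner p : E →L[ℝ] E →L[ℝ] ℝ) x y := by
    subst hq; rfl
  rw [← hg p 1 v w]
  exact (key _ (mul_one p) _ _).symm

lemma mdifferentiableAt_inner (g : Metric I G) {Y Z : (q : G) → TangentSpace I q} {p : G}
    (hY : MDiffAt (T% Y) p) (hZ : MDiffAt (T% Z) p) :
    MDifferentiableAt I 𝓘(ℝ, ℝ) (fun q ↦ g.inner q (Y q) (Z q)) p := by
  have : MDifferentiableAt I (I.prod 𝓘(ℝ, ℝ))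
      (fun q ↦ Bundle.TotalSpace.mk' ℝ (E := Bundle.Trivial G ℝ) q (g.inner q (Y q) (Z q))) p :=
    MDifferentiableAt.clm_bundle_apply₂ (F₁ := E) (F₂ := E) (b := fun q ↦ q)
      (g.contMDiff.mdifferentiableAt (by simp)) hY hZ
  simp only [mdifferentiableAt_totalSpace] at this
  exact this.2

variable {ι : Type*} [Fintype ι] (b : Module.Basis ι ℝ (GroupLieAlgebra I G))

/-- The left-invariant frame given by a basis of the Lie algebra. -/
def frame (p : G) : Module.Basis ι ℝ (TangentSpace I p) := b.map (leftEquiv p)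

lemma frame_apply (p : G) (i : ι) : frame b p i = mulInvariantVectorField (b i) p := by
  simp [frame, leftEquiv_apply]

lemma mdifferentiableAt_frame (p : G) (i : ι) : MDiffAt (T% (fun q ↦ frame b q i)) p := by
  simp only [frame_apply]
  exact mdifferentiableAt_mulInvariantVectorField _

lemma mdifferentiableAt_mulInvariant (p : G) (v : GroupLieAlgebra I G) :
    MDiffAt (T% (mulInvariantVectorField v)) p :=
  mdifferentiableAt_mulInvariantVectorField _

variable [DecidableEq ι]

/-- `b` is orthonormal for `g`. -/
def IsOrthonormalFor (g : Metric I G) : Prop :=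
  ∀ i j, g.inner 1 (b i) (b j) = if i = j then 1 else 0

variable {b}

lemma IsOrthonormalFor.frame (hb : IsOrthonormalFor b g) (hg : IsLeftInvariant g) (p : G)
    (i j : ι) : g.inner p (frame b p i) (frame b p j) = if i = j then 1 else 0 := by
  simp only [LeftInvariantRicci.frame, Module.Basis.map_apply]
  rw [hg.inner_leftEquiv, hb i j]

lemma IsOrthonormalFor.inner_frame (hb : IsOrthonormalFor b g) (hg : IsLeftInvariant g) (p : G)
    (v : TangentSpace I p) (i : ι) :
    g.inner p v (LeftInvariantRicci.frame b p i) = (LeftInvariantRicci.frame b p).repr v i := by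
  conv_lhs => rw [← (LeftInvariantRicci.frame b p).sum_repr v]
  simp only [map_sum, map_smul, _root_.sum_apply, _root_.smul_apply,
    hb.frame hg]
  simp

lemma IsOrthonormalFor.inner_eq_sum (hb : IsOrthonormalFor b g) (hg : IsLeftInvariant g) (p : G)
    (v w : TangentSpace I p) :
    g.inner p v w = ∑ i, (LeftInvariantRicci.frame b p).repr v i *
      (LeftInvariantRicci.frame b p).repr w i := by
  conv_lhs => rw [← (LeftInvariantRicci.frame b p).sum_repr w]
  simp only [map_sum, map_smul, hb.inner_frame hg, smul_eq_mul, mul_comm]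

lemma IsOrthonormalFor.mdifferentiableAt_repr (hb : IsOrthonormalFor b g) (hg : IsLeftInvariant g)
    {Y : (q : G) → TangentSpace I q} {p : G} (hY : MDiffAt (T% Y) p) (i : ι) :
    MDifferentiableAt I 𝓘(ℝ, ℝ) (fun q ↦ (LeftInvariantRicci.frame b q).repr (Y q) i) p := by
  simp only [← hb.inner_frame hg]
  exact mdifferentiableAt_inner g hY (mdifferentiableAt_frame b p i)

end Geometry

section LeviCivita

variable {E : Type*} [NormedAddCommGroup E] [NormedSpace ℝ E] [FiniteDimensional ℝ E]
  {H : Type*} [TopologicalSpace H] {I : ModelWithCorners ℝ E H}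
  {G : Type*} [TopologicalSpace G] [ChartedSpace H G] [Group G] [LieGroup I ∞ G]
  {g : Metric I G} {ι : Type*} [Fintype ι] [DecidableEq ι]
  {b : Module.Basis ι ℝ (GroupLieAlgebra I G)}

variable (g b) in
/-- The components of the Levi-Civita derivative with respect to a left-invariant frame. -/
def leviCivitaComponent (Y : (q : G) → TangentSpace I q) (p : G) (k : ι) :
    TangentSpace I p →L[ℝ] ℝ :=
  mvfderiv I (fun q ↦ (frame b q).repr (Y q) k) p +
    ∑ i, ∑ j, (christoffel (structureConstants b) i j k * (frame b p).repr (Y p) j) •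
      g.inner p (frame b p i)

variable (g b) in
/-- The Levi-Civita derivative in a left-invariant orthonormal frame. -/
def leviCivitaFun (Y : (q : G) → TangentSpace I q) (p : G) :
    TangentSpace I p →L[ℝ] TangentSpace I p :=
  ∑ k, (leviCivitaComponent g b Y p k).smulRight (frame b p k)

omit [DecidableEq ι] in
lemma repr_leviCivitaFun (Y : (q : G) → TangentSpace I q) (p : G) (v : TangentSpace I p) (k : ι) :
    (frame b p).repr (leviCivitaFun g b Y p v) k = leviCivitaComponent g b Y p k v := by
  classical
  simp [leviCivitaFun, Finsupp.single_apply]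

lemma IsOrthonormalFor.leviCivitaComponent_apply (hb : IsOrthonormalFor b g)
    (hg : IsLeftInvariant g) (Y : (q : G) → TangentSpace I q) (p : G) (v : TangentSpace I p)
    (k : ι) : leviCivitaComponent g b Y p k v =
      mvfderiv I (fun q ↦ (LeftInvariantRicci.frame b q).repr (Y q) k) p v +
      ∑ i, ∑ j, christoffel (structureConstants b) i j k *
        (LeftInvariantRicci.frame b p).repr (Y p) j *
        (LeftInvariantRicci.frame b p).repr v i := by
  simp only [leviCivitaComponent, _root_.add_apply, _root_.sum_apply,
    _root_.smul_apply, smul_eq_mul]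
  simp only [g.symm p _ v, hb.inner_frame hg]

lemma IsOrthonormalFor.isCovariantDerivativeOn_leviCivitaFun (hb : IsOrthonormalFor b g)
    (hg : IsLeftInvariant g) : IsCovariantDerivativeOn E (leviCivitaFun g b) Set.univ where
  add {Y Z p} hY hZ _ := by
    ext v
    refine (LeftInvariantRicci.frame b p).ext_elem fun k ↦ ?_
    simp only [_root_.add_apply, map_add, Finsupp.add_apply, repr_leviCivitaFun,
      hb.leviCivitaComponent_apply hg, Pi.add_apply, mul_add, add_mul, Finset.sum_add_distrib]
    rw [mvfderiv_fun_add (hb.mdifferentiableAt_repr hg hY k) (hb.mdifferentiableAt_repr hg hZ k)]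
    simp only [_root_.add_apply]
    ring
  leibniz {Y f p} hY hf _ := by
    ext v
    refine (LeftInvariantRicci.frame b p).ext_elem fun k ↦ ?_
    simp only [_root_.add_apply, map_add, Finsupp.add_apply, repr_leviCivitaFun,
      hb.leviCivitaComponent_apply hg, Pi.smul_apply', map_smul, Finsupp.smul_apply,
      _root_.smul_apply, ContinuousLinearMap.smulRight_apply, smul_eq_mul]
    rw [mvfderiv_fun_mul hf (hb.mdifferentiableAt_repr hg hY k)]
    simp only [_root_.add_apply, _root_.smul_apply, smul_eq_mul,
      mul_add, Finset.mul_sum]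
    have (i j : ι) : christoffel (structureConstants b) i j k *
        (f p * (LeftInvariantRicci.frame b p).repr (Y p) j) *
        (LeftInvariantRicci.frame b p).repr v i = f p *
        (christoffel (structureConstants b) i j k * (LeftInvariantRicci.frame b p).repr (Y p) j *
        (LeftInvariantRicci.frame b p).repr v i) := by ring
    simp only [this]
    ring

/-- The Levi-Civita connection of a left-invariant metric. -/
def leviCivita (hb : IsOrthonormalFor b g) (hg : IsLeftInvariant g) : Connection I G where
  toFun := leviCivitaFun g b
  isCovariantDerivativeOnUniv := hb.isCovariantDerivativeOn_leviCivitaFun hg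

lemma IsOrthonormalFor.repr_leviCivita_frame (hb : IsOrthonormalFor b g) (hg : IsLeftInvariant g)
    (p : G) (i j k : ι) :
    (LeftInvariantRicci.frame b p).repr (leviCivitaFun g b
      (mulInvariantVectorField (b j)) p (LeftInvariantRicci.frame b p i)) k =
      christoffel (structureConstants b) i j k := by
  have h (q : G) : (mulInvariantVectorField (b j) : (q : G) → TangentSpace I q) q =
    LeftInvariantRicci.frame b q j := (frame_apply b q j).symm
  rw [repr_leviCivitaFun, hb.leviCivitaComponent_apply hg]
  simp only [h, Module.Basis.repr_self]
  simp [mvfderiv_const, Finsupp.single_apply]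

lemma christoffel_compat (c : ι → ι → ι → ℝ) (hc : ∀ i j k, c i j k = - c j i k) (i j k : ι) :
    christoffel c i j k + christoffel c i k j = 0 := by
  simp only [christoffel, hc i k j, hc j i k, hc k j i]; ring

lemma christoffel_torsion (c : ι → ι → ι → ℝ) (hc : ∀ i j k, c i j k = - c j i k) (i j k : ι) :
    christoffel c i j k - christoffel c j i k = c i j k := by
  simp only [christoffel, hc j i k, hc k j i, hc i k j]; ring

lemma sum_mul_add_mul_christoffel (c : ι → ι → ι → ℝ) (hc : ∀ i j k, c i j k = - c j i k)
    (y z w dy dz : ι → ℝ) :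
    ∑ k, (y k * dz k + z k * dy k) =
      ∑ k, (dy k + ∑ i, ∑ j, christoffel c i j k * y j * w i) * z k +
      ∑ k, y k * (dz k + ∑ i, ∑ j, christoffel c i j k * z j * w i) := by
  have h : (∑ k, (∑ i, ∑ j, christoffel c i j k * y j * w i) * z k) +
      ∑ k, y k * (∑ i, ∑ j, christoffel c i j k * z j * w i) = 0 := by
    have h' : ∑ k, y k * (∑ i, ∑ j, christoffel c i j k * z j * w i) =
        ∑ k, ∑ i, ∑ j, christoffel c i k j * z k * w i * y j := by
      simp only [Finset.mul_sum]
      rw [Finset.sum_comm]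
      conv_rhs => rw [Finset.sum_comm]
      refine Finset.sum_congr rfl fun i _ ↦ ?_
      rw [Finset.sum_comm]
      refine Finset.sum_congr rfl fun j _ ↦ Finset.sum_congr rfl fun k _ ↦ ?_
      ring
    rw [h', ← Finset.sum_add_distrib]
    refine Finset.sum_eq_zero fun k _ ↦ ?_
    rw [Finset.sum_mul, ← Finset.sum_add_distrib]
    refine Finset.sum_eq_zero fun i _ ↦ ?_
    rw [Finset.sum_mul, ← Finset.sum_add_distrib]
    refine Finset.sum_eq_zero fun j _ ↦ ?_
    linear_combination y j * w i * z k * christoffel_compat _ hc i j k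
  simp only [add_mul, mul_add, Finset.sum_add_distrib, mul_comm (z _) (dy _)]
  linear_combination -h

lemma frame_repr_leftEquiv (p : G) (v : GroupLieAlgebra I G) (k : ι) :
    (frame b p).repr (leftEquiv p v) k = b.repr v k := by
  simp [frame]

lemma IsOrthonormalFor.isLeviCivita_leviCivita (hb : IsOrthonormalFor b g)
    (hg : IsLeftInvariant g) : IsLeviCivita g (leviCivita hb hg) := by
  constructor
  · funext p
    have key (i j : ι) : (leviCivita hb hg).torsion p (LeftInvariantRicci.frame b p i)
        (LeftInvariantRicci.frame b p j) = 0 := by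
      have h := (leviCivita hb hg).torsion_apply (mdifferentiableAt_mulInvariant p (b i))
        (mdifferentiableAt_mulInvariant p (b j))
      simp only [← frame_apply, mlieBracket_mulInvariantVectorField] at h
      rw [h]
      refine (LeftInvariantRicci.frame b p).ext_elem fun k ↦ ?_
      have h1 := hb.repr_leviCivita_frame hg p i j k
      have h2 := hb.repr_leviCivita_frame hg p j i k
      simp only [map_sub, Finsupp.sub_apply, frame_repr_leftEquiv]
      erw [h1, h2]
      rw [christoffel_torsion _ (structureConstants_skew b)]
      simp [structureConstants]
    have : (leviCivita hb hg).torsion p = 0 := by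
      ext x y
      rw [← (LeftInvariantRicci.frame b p).sum_repr x, ← (LeftInvariantRicci.frame b p).sum_repr y]
      simp only [map_sum, map_smul, _root_.sum_apply, _root_.smul_apply,
        key]
      simp
    exact this
  · intro p v Y Z hY hZ
    have hf : (fun q ↦ g.inner q (Y q) (Z q)) = fun q ↦ ∑ i,
        (LeftInvariantRicci.frame b q).repr (Y q) i *
        (LeftInvariantRicci.frame b q).repr (Z q) i := funext fun q ↦ hb.inner_eq_sum hg q _ _
    rw [hf]
    have hd : mfderiv I 𝓘(ℝ, ℝ) (fun q ↦ ∑ i, (LeftInvariantRicci.frame b q).repr (Y q) i *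
        (LeftInvariantRicci.frame b q).repr (Z q) i) p v =
        ∑ k, ((LeftInvariantRicci.frame b p).repr (Y p) k *
          mvfderiv I (fun q ↦ (LeftInvariantRicci.frame b q).repr (Z q) k) p v +
          (LeftInvariantRicci.frame b p).repr (Z p) k *
          mvfderiv I (fun q ↦ (LeftInvariantRicci.frame b q).repr (Y q) k) p v) := by
      have (s : Finset ι) : MDifferentiableAt I 𝓘(ℝ, ℝ) (fun q ↦ ∑ i ∈ s,
          (LeftInvariantRicci.frame b q).repr (Y q) i *
          (LeftInvariantRicci.frame b q).repr (Z q) i) p ∧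
          mvfderiv I (fun q ↦ ∑ i ∈ s, (LeftInvariantRicci.frame b q).repr (Y q) i *
          (LeftInvariantRicci.frame b q).repr (Z q) i) p v =
          ∑ k ∈ s, ((LeftInvariantRicci.frame b p).repr (Y p) k *
          mvfderiv I (fun q ↦ (LeftInvariantRicci.frame b q).repr (Z q) k) p v +
          (LeftInvariantRicci.frame b p).repr (Z p) k *
          mvfderiv I (fun q ↦ (LeftInvariantRicci.frame b q).repr (Y q) k) p v) := by
        induction s using Finset.induction_on with
        | empty => simp [mvfderiv_const, mdifferentiableAt_const]
        | insert i s hi ih =>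
          have hYi := hb.mdifferentiableAt_repr hg hY i
          have hZi := hb.mdifferentiableAt_repr hg hZ i
          have hm : MDifferentiableAt I 𝓘(ℝ, ℝ) (fun q ↦
              (LeftInvariantRicci.frame b q).repr (Y q) i *
              (LeftInvariantRicci.frame b q).repr (Z q) i) p := hYi.mul hZi
          simp only [Finset.sum_insert hi]
          refine ⟨hm.add ih.1, ?_⟩
          rw [mvfderiv_fun_add hm ih.1, _root_.add_apply, ih.2]
          congr 1
          erw [mvfderiv_fun_mul hYi hZi]
          simp
      exact (this Finset.univ).2
    refine hd.trans (Eq.trans ?_ (congrArg₂ (· + ·)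
      (hb.inner_eq_sum hg p (leviCivitaFun g b Y p v) (Z p))
      (hb.inner_eq_sum hg p (Y p) (leviCivitaFun g b Z p v))).symm)
    simp only [repr_leviCivitaFun, hb.leviCivitaComponent_apply hg]
    exact sum_mul_add_mul_christoffel _ (structureConstants_skew b) _ _ _ _ _

end LeviCivita

section RicciOperator

variable {E : Type*} [NormedAddCommGroup E] [NormedSpace ℝ E] [FiniteDimensional ℝ E]
  {H : Type*} [TopologicalSpace H] {I : ModelWithCorners ℝ E H}
  {G : Type*} [TopologicalSpace G] [ChartedSpace H G] [Group G] [LieGroup I ∞ G]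
  {g : Metric I G} {ι : Type*} [Fintype ι] [DecidableEq ι]
  {b : Module.Basis ι ℝ (GroupLieAlgebra I G)}

lemma cov_mulInvariantVectorField_add (cov : Connection I G) (v w : GroupLieAlgebra I G) (p : G) :
    cov (mulInvariantVectorField (v + w)) p =
      cov (mulInvariantVectorField v) p + cov (mulInvariantVectorField w) p := by
  rw [mulInvariantVectorField_add]
  exact cov.isCovariantDerivativeOnUniv.add (mdifferentiableAt_mulInvariant p v)
    (mdifferentiableAt_mulInvariant p w)

lemma cov_mulInvariantVectorField_smul (cov : Connection I G) (r : ℝ) (v : GroupLieAlgebra I G)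
    (p : G) : cov (mulInvariantVectorField (r • v)) p = r • cov (mulInvariantVectorField v) p := by
  rw [mulInvariantVectorField_smul]
  exact cov.isCovariantDerivativeOnUniv.smul_const r (mdifferentiableAt_mulInvariant p v)

/-- A connection at a point, evaluated on left-invariant vector fields. -/
def covAt (cov : Connection I G) (p : G) :
    GroupLieAlgebra I G →ₗ[ℝ] GroupLieAlgebra I G →ₗ[ℝ] TangentSpace I p :=
  LinearMap.mk₂ ℝ (fun v w ↦ cov (mulInvariantVectorField w) p (leftEquiv p v))
    (fun v v' w ↦ by simp) (fun r v w ↦ by simp)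
    (fun v w w' ↦ by simp [cov_mulInvariantVectorField_add])
    (fun r v w ↦ by simp [cov_mulInvariantVectorField_smul])

lemma IsLeviCivita.compat_covAt {cov : Connection I G} (h : IsLeviCivita g cov)
    (hg : IsLeftInvariant g) (p : G) (u v w : GroupLieAlgebra I G) :
    g.inner p (covAt cov p u v) (leftEquiv p w) + g.inner p (leftEquiv p v) (covAt cov p u w)
      = 0 := by
  have h1 := h.2 p (leftEquiv p u) _ _ (mdifferentiableAt_mulInvariant p v)
    (mdifferentiableAt_mulInvariant p w)
  have h2 : (fun q ↦ g.inner q (mulInvariantVectorField v q) (mulInvariantVectorField w q)) =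
      fun _ ↦ g.inner 1 v w := funext fun q ↦ hg.inner_leftEquiv q v w
  rw [h2, mfderiv_const] at h1
  exact h1.symm

lemma IsLeviCivita.torsion_covAt {cov : Connection I G} (h : IsLeviCivita g cov)
    (p : G) (u v : GroupLieAlgebra I G) :
    covAt cov p u v - covAt cov p v u = leftEquiv p ⁅u, v⁆ := by
  rw [← mlieBracket_mulInvariantVectorField]
  exact cov.torsion_eq_zero_iff.1 h.1 (mdifferentiableAt_mulInvariant p u)
    (mdifferentiableAt_mulInvariant p v)

/-- The Koszul formula for left-invariant vector fields. -/
lemma IsLeviCivita.covAt_eq {cov : Connection I G} (h : IsLeviCivita g cov)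
    (hb : IsOrthonormalFor b g) (hg : IsLeftInvariant g) (p : G) (u v : GroupLieAlgebra I G) :
    covAt cov p u v = leftEquiv p (nabla b u v) := by
  let coef (i j k : ι) : ℝ := (frame b p).repr (covAt cov p (b i) (b j)) k
  have h_coef (i j k : ι) : g.inner p (covAt cov p (b i) (b j)) (leftEquiv p (b k)) = coef i j k := by
    simp only [coef, ← hb.inner_frame hg]
    rfl
  have hcompat (i j k : ι) : coef i j k + coef i k j = 0 := by
    rw [← h.compat_covAt hg p (b i) (b j) (b k), h_coef, g.symm, h_coef]
  have htors (i j k : ι) : coef i j k - coef j i k = structureConstants b i j k := by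
    simp only [coef]
    rw [← Finsupp.sub_apply, ← map_sub, h.torsion_covAt, frame_repr_leftEquiv, structureConstants]
  have hmain : covAt cov p = (nabla b).compr₂ (leftEquiv p).toLinearMap := by
    refine b.ext fun i ↦ b.ext fun j ↦ (frame b p).ext_elem fun k ↦ ?_
    rw [LinearMap.compr₂_apply, LinearEquiv.coe_coe, frame_repr_leftEquiv, repr_nabla_basis,
      christoffel, ← htors, ← htors, ← htors]
    change coef i j k = _
    linear_combination (hcompat i j k + hcompat j k i - hcompat k i j) / 2
  rw [hmain]
  rfl

lemma IsLeviCivita.curvature_eq {cov : Connection I G} (h : IsLeviCivita g cov)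
    (hb : IsOrthonormalFor b g) (hg : IsLeftInvariant g) (p : G) (u v w : GroupLieAlgebra I G) :
    curvature cov (mulInvariantVectorField u) (mulInvariantVectorField v)
      (mulInvariantVectorField w) p = leftEquiv p (curvatureOperator b v w u) := by
  have h1 (u v : GroupLieAlgebra I G) :
      (fun q ↦ cov (mulInvariantVectorField v) q (mulInvariantVectorField u q)) =
        mulInvariantVectorField (nabla b u v) := funext fun q ↦ h.covAt_eq hb hg q u v
  rw [curvature, h1, h1, mlieBracket_mulInvariantVectorField, curvatureOperator_apply, map_sub,
    map_sub, ← h.covAt_eq hb hg, ← h.covAt_eq hb hg, ← h.covAt_eq hb hg]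
  rfl

lemma isRicciOperator_iff (hb : IsOrthonormalFor b g) (hg : IsLeftInvariant g) (p : G)
    (A : TangentSpace I p →ₗ[ℝ] TangentSpace I p) :
    IsRicciOperator g p A ↔ A = (leftEquiv p).conj (algRicciOperator b) := by
  have hinner (y z : GroupLieAlgebra I G) :
      g.inner p (leftEquiv p (algRicciOperator b y)) (leftEquiv p z) = ricciForm b y z := by
    rw [hg.inner_leftEquiv]
    exact apply_algRicciOperator b
      (h := (ContinuousLinearMap.coeLM ℝ).comp (g.inner 1).toLinearMap) hb y z
  constructor
  · rintro ⟨cov, hcov, hA⟩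
    refine (frame b p).ext fun i ↦ (frame b p).ext_elem fun j ↦ ?_
    rw [← hb.inner_frame hg, ← hb.inner_frame hg]
    obtain ⟨T, hT, hAT⟩ := hA (frame b p i) (frame b p j)
    rw [hAT]
    have hT' : T = (leftEquiv p).conj (curvatureOperator b (b i) (b j)) := by
      ext x
      rw [hT, leftExtension_eq, leftExtension_eq, leftExtension_eq, hcov.curvature_eq hb hg]
      simp [frame, LinearEquiv.conj_apply]
    rw [hT', LinearMap.trace_conj']
    simp only [frame, Module.Basis.map_apply, LinearEquiv.conj_apply, LinearMap.comp_apply,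
      LinearEquiv.coe_coe, LinearEquiv.symm_apply_apply]
    rw [hinner]
    rfl
  · rintro rfl
    refine ⟨leviCivita hb hg, hb.isLeviCivita_leviCivita hg, fun y z ↦
      ⟨(leftEquiv p).conj (curvatureOperator b ((leftEquiv p).symm y) ((leftEquiv p).symm z)),
        fun x ↦ ?_, ?_⟩⟩
    · rw [leftExtension_eq, leftExtension_eq, leftExtension_eq,
        (hb.isLeviCivita_leviCivita hg).curvature_eq hb hg]
      rfl
    · rw [LinearMap.trace_conj']
      have := hinner ((leftEquiv p).symm y) ((leftEquiv p).symm z)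
      rw [LinearEquiv.apply_symm_apply] at this
      exact this

lemma ricciOperator_eq (hb : IsOrthonormalFor b g) (hg : IsLeftInvariant g) (p : G) :
    ricciOperator g p = (leftEquiv p).conj (algRicciOperator b) :=
  (isRicciOperator_iff hb hg p _).1 <|
    Classical.epsilon_spec ⟨_, (isRicciOperator_iff hb hg p _).2 rfl⟩

theorem eigenvalues_ricciOperator (hb : IsOrthonormalFor b g) (hg : IsLeftInvariant g) (p : G) :
    eigenvalues (ricciOperator g p) = (ricciMatrix (structureConstants b)).charpoly.roots := by
  rw [eigenvalues, ricciOperator_eq hb hg, LinearEquiv.charpoly_conj, charpoly_algRicciOperator]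

end RicciOperator

/-- The structure constants of the extension of a three-dimensional unimodular Lie algebra, with
`[e₂, e₃] = l 0 • e₁`, `[e₃, e₁] = l 1 • e₂`, `[e₁, e₂] = l 2 • e₃`, by an element `e₀` which acts
through the matrix `D`. -/
def extensionConstants (l : Fin 3 → ℝ) (D : Matrix (Fin 3) (Fin 3) ℝ) :
    Fin 4 → Fin 4 → Fin 4 → ℝ :=
  ![![![0, 0, 0, 0], ![0, D 0 0, D 1 0, D 2 0], ![0, D 0 1, D 1 1, D 2 1],
      ![0, D 0 2, D 1 2, D 2 2]],
    ![![0, -D 0 0, -D 1 0, -D 2 0], ![0, 0, 0, 0], ![0, 0, 0, l 2], ![0, 0, -l 1, 0]],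
    ![![0, -D 0 1, -D 1 1, -D 2 1], ![0, 0, 0, -l 2], ![0, 0, 0, 0], ![0, l 0, 0, 0]],
    ![![0, -D 0 2, -D 1 2, -D 2 2], ![0, 0, l 1, 0], ![0, -l 0, 0, 0], ![0, 0, 0, 0]]]

variable (l : Fin 3 → ℝ) (D : Matrix (Fin 3) (Fin 3) ℝ)

set_option maxHeartbeats 1000000 in
lemma ricciMatrix_extensionConstants_isSymm :
    (ricciMatrix (extensionConstants l D)).IsSymm := by
  have h (i j : Fin 4) (hij : i < j) :
      ricciMatrix (extensionConstants l D) i j = ricciMatrix (extensionConstants l D) j i := by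
    fin_cases i <;> fin_cases j <;> first
    | exact absurd hij (by decide)
    | simp [ricciMatrix, christoffel, extensionConstants, Fin.sum_univ_four]
      ring
  refine Matrix.IsSymm.ext fun i j ↦ ?_
  obtain hij | rfl | hij := lt_trichotomy i j
  exacts [(h i j hij).symm, rfl, h j i hij]

lemma ricciMatrix_extensionConstants_zero_zero :
    ricciMatrix (extensionConstants l D) 0 0 = -(D 0 0 ^ 2 + D 1 1 ^ 2 + D 2 2 ^ 2 +
      ((D 0 1 + D 1 0) ^ 2 + (D 0 2 + D 2 0) ^ 2 + (D 1 2 + D 2 1) ^ 2) / 2) := by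
  simp [ricciMatrix, christoffel, extensionConstants, Fin.sum_univ_four]
  ring

lemma ricciMatrix_extensionConstants_zero_succ (i : Fin 3) :
    ricciMatrix (extensionConstants l D) 0 i.succ =
      (l (i + 1) - l (i + 2)) * (D (i + 1) (i + 2) + D (i + 2) (i + 1)) / 2 := by
  fin_cases i <;>
  · simp [ricciMatrix, christoffel, extensionConstants, Fin.sum_univ_four]
    ring

lemma ricciMatrix_extensionConstants_succ_succ (i : Fin 3) :
    ricciMatrix (extensionConstants l D) i.succ i.succ =
      (l i ^ 2 - (l (i + 1) - l (i + 2)) ^ 2) / 2 +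
      (D i (i + 1) ^ 2 + D i (i + 2) ^ 2 - D (i + 1) i ^ 2 - D (i + 2) i ^ 2) / 2 -
      (D 0 0 + D 1 1 + D 2 2) * D i i := by
  fin_cases i <;>
  · simp [ricciMatrix, christoffel, extensionConstants, Fin.sum_univ_four]
    ring

/-- A real symmetric matrix with a negative definite principal minor of size two has at least two
negative eigenvalues. -/
lemma two_le_countP_roots_charpoly {n : Type*} [Fintype n] [DecidableEq n] {A : Matrix n n ℝ}
    (hA : A.IsSymm) (i j : n) (hi : A i i < 0) (hij : 0 < A i i * A j j - A i j ^ 2) :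
    2 ≤ A.charpoly.roots.countP (· < 0) := by
  have hH : A.IsHermitian := by
    rwa [Matrix.IsHermitian, Matrix.conjTranspose_eq_transpose_of_trivial]
  set U : Matrix n n ℝ := hH.eigenvectorUnitary.1
  set ev : n → ℝ := hH.eigenvalues
  have hsp (a b : n) : A a b = ∑ k, ev k * (U a k * U b k) := by
    conv_lhs => rw [hH.spectral_theorem]
    simp [Unitary.conjStarAlgAut_apply, Matrix.mul_apply, Matrix.diagonal_apply, U, ev,
      Matrix.star_eq_conjTranspose]
    refine Finset.sum_congr rfl fun k _ ↦ by ring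
  rw [hH.roots_charpoly_eq_eigenvalues, Multiset.countP_map]
  by_contra hlt
  have hcard : (Finset.univ.filter fun k ↦ ev k < 0).card ≤ 1 := by
    simpa [Finset.card, Finset.filter] using Nat.le_of_lt_succ (not_le.1 hlt)
  have : Nonempty n := ⟨i⟩
  obtain ⟨k₀, hk₀⟩ := Finset.card_le_one_iff_subset_singleton.1 hcard
  have hnn (k : n) (hk : k ≠ k₀) : 0 ≤ ev k := by
    by_contra hneg
    exact hk (Finset.mem_singleton.1 (hk₀ (by simpa using hneg)))
  obtain ⟨s, t, hst, h0⟩ : ∃ s t : ℝ, (s ≠ 0 ∨ t ≠ 0) ∧ s * U i k₀ + t * U j k₀ = 0 := by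
    by_cases h : U j k₀ = 0 ∧ U i k₀ = 0
    · exact ⟨1, 0, by simp, by simp [h.2]⟩
    · refine ⟨U j k₀, -U i k₀, ?_, by ring⟩
      simpa [or_iff_not_imp_left] using h
  have hQ : s ^ 2 * A i i + 2 * s * t * A i j + t ^ 2 * A j j =
      ∑ k, ev k * (s * U i k + t * U j k) ^ 2 := by
    simp only [hsp, Finset.mul_sum, ← Finset.sum_add_distrib]
    refine Finset.sum_congr rfl fun k _ ↦ by ring
  have hQ0 : 0 ≤ s ^ 2 * A i i + 2 * s * t * A i j + t ^ 2 * A j j := by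
    rw [hQ]
    refine Finset.sum_nonneg fun k _ ↦ ?_
    by_cases hk : k = k₀
    · simp [hk, h0]
    · exact mul_nonneg (hnn k hk) (sq_nonneg _)
  have hneg := mul_nonpos_of_nonpos_of_nonneg hi.le hQ0
  have hid : A i i * (s ^ 2 * A i i + 2 * s * t * A i j + t ^ 2 * A j j) =
    (s * A i i + t * A i j) ^ 2 + t ^ 2 * (A i i * A j j - A i j ^ 2) := by ring
  have ht : t = 0 := by
    by_contra ht
    have := mul_pos (pow_pos (abs_pos.2 ht) 2) hij
    rw [sq_abs] at this
    nlinarith [sq_nonneg (s * A i i + t * A i j)]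
  have hs : s ≠ 0 := by simpa [ht] using hst
  have : 0 < s ^ 2 := by positivity
  rw [ht] at hQ0
  nlinarith

/-- The equations expressing that the matrix `D` is a derivation of the three-dimensional
unimodular Lie algebra with structure constants `l`. -/
structure IsUnimodularDerivation (l : Fin 3 → ℝ) (D : Matrix (Fin 3) (Fin 3) ℝ) : Prop where
  diag (i : Fin 3) : l i * D i i = l i * (D (i + 1) (i + 1) + D (i + 2) (i + 2))
  offDiag (i j : Fin 3) (h : i ≠ j) : D i j * l j + l i * D j i = 0

/-- The two-dimensional principal minors of the Ricci matrix which contain the first row. -/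
def ricciMinor (l : Fin 3 → ℝ) (D : Matrix (Fin 3) (Fin 3) ℝ) (i : Fin 3) : ℝ :=
  ricciMatrix (extensionConstants l D) 0 0 * ricciMatrix (extensionConstants l D) i.succ i.succ -
    ricciMatrix (extensionConstants l D) 0 i.succ ^ 2

lemma ricciMinor_eq (l : Fin 3 → ℝ) (D : Matrix (Fin 3) (Fin 3) ℝ) (i : Fin 3) :
    ricciMinor l D i = -(D 0 0 ^ 2 + D 1 1 ^ 2 + D 2 2 ^ 2 +
      ((D 0 1 + D 1 0) ^ 2 + (D 0 2 + D 2 0) ^ 2 + (D 1 2 + D 2 1) ^ 2) / 2) *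
      ((l i ^ 2 - (l (i + 1) - l (i + 2)) ^ 2) / 2 +
      (D i (i + 1) ^ 2 + D i (i + 2) ^ 2 - D (i + 1) i ^ 2 - D (i + 2) i ^ 2) / 2 -
      (D 0 0 + D 1 1 + D 2 2) * D i i) -
      ((l (i + 1) - l (i + 2)) * (D (i + 1) (i + 2) + D (i + 2) (i + 1)) / 2) ^ 2 := by
  rw [ricciMinor, ricciMatrix_extensionConstants_zero_zero,
    ricciMatrix_extensionConstants_zero_succ, ricciMatrix_extensionConstants_succ_succ]

lemma ricciMinor_rotate (l : Fin 3 → ℝ) (D : Matrix (Fin 3) (Fin 3) ℝ) (k i : Fin 3) :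
    ricciMinor (fun i ↦ l (i + k)) (D.submatrix (· + k) (· + k)) i = ricciMinor l D (i + k) := by
  simp only [ricciMinor_eq]
  fin_cases k <;> fin_cases i <;> simp <;> ring

lemma IsUnimodularDerivation.rotate {l : Fin 3 → ℝ} {D : Matrix (Fin 3) (Fin 3) ℝ}
    (h : IsUnimodularDerivation l D) (k : Fin 3) :
    IsUnimodularDerivation (fun i ↦ l (i + k)) (D.submatrix (· + k) (· + k)) where
  diag i := by simpa only [Matrix.submatrix_apply, add_right_comm _ k] using h.diag (i + k)
  offDiag i j hij := h.offDiag _ _ (by simpa using hij)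

lemma exists_ricciMinor_pos_of_rank_two {l : Fin 3 → ℝ} {D : Matrix (Fin 3) (Fin 3) ℝ}
    (h : IsUnimodularDerivation l D) (hD : D 0 0 + D 1 1 + D 2 2 ≠ 0)
    (h0 : l 0 ≠ 0) (h1 : l 1 ≠ 0) (h2 : l 2 = 0) : ∃ i, 0 < ricciMinor l D i := by
  have e0 : D 0 0 = D 1 1 + D 2 2 := mul_left_cancel₀ h0 (h.diag 0)
  have e1 : D 1 1 = D 2 2 + D 0 0 := mul_left_cancel₀ h1 (h.diag 1)
  have e22 : D 2 2 = 0 := by linarith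
  have e11 : D 1 1 = D 0 0 := by linarith
  have e20 : D 2 0 = 0 := by simpa [h2, h0] using h.offDiag 0 2 (by decide)
  have e21 : D 2 1 = 0 := by simpa [h2, h1] using h.offDiag 1 2 (by decide)
  have e10 := h.offDiag 0 1 (by decide)
  have ht : D 0 0 ≠ 0 := fun h ↦ hD (by rw [e22, e11, h]; ring)
  have ht2 : 0 < D 0 0 ^ 2 := by positivity
  have hR2 : ricciMinor l D 2 = (2 * D 0 0 ^ 2 + (D 0 2 ^ 2 + D 1 2 ^ 2) / 2) *
      ((l 0 - l 1) ^ 2 + D 0 2 ^ 2 + D 1 2 ^ 2) / 2 +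
      (D 0 1 + D 1 0) ^ 2 * (D 0 2 ^ 2 + D 1 2 ^ 2) / 4 := by
    rw [ricciMinor_eq]
    simp [e22, e11, e20, e21, h2]
    ring
  by_cases hpos : 0 < (l 0 - l 1) ^ 2 + D 0 2 ^ 2 + D 1 2 ^ 2
  · refine ⟨2, ?_⟩
    rw [hR2]
    positivity
  · have f1 : l 1 = l 0 := by
      have : (l 0 - l 1) ^ 2 = 0 := by nlinarith [sq_nonneg (l 0 - l 1), sq_nonneg (D 0 2), sq_nonneg (D 1 2)]
      linarith [pow_eq_zero_iff (two_ne_zero) |>.1 this]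
    have f2 : D 0 2 = 0 := by
      refine pow_eq_zero_iff (two_ne_zero) |>.1 ?_
      nlinarith [sq_nonneg (l 0 - l 1), sq_nonneg (D 0 2), sq_nonneg (D 1 2)]
    have f3 : D 1 2 = 0 := by
      refine pow_eq_zero_iff (two_ne_zero) |>.1 ?_
      nlinarith [sq_nonneg (l 0 - l 1), sq_nonneg (D 0 2), sq_nonneg (D 1 2)]
    have f4 : D 1 0 = - D 0 1 := by
      rw [f1] at e10
      refine mul_left_cancel₀ h0 ?_
      linarith
    refine ⟨0, ?_⟩
    have : ricciMinor l D 0 = 4 * (D 0 0 ^ 2) ^ 2 := by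
      rw [ricciMinor_eq]
      simp [e22, e11, e20, e21, h2, f1, f2, f3, f4]
      ring
    rw [this]
    positivity

lemma strain_pos {D : Matrix (Fin 3) (Fin 3) ℝ} (hD : D 0 0 + D 1 1 + D 2 2 ≠ 0) :
    0 < D 0 0 ^ 2 + D 1 1 ^ 2 + D 2 2 ^ 2 := by
  by_contra h
  have := sq_nonneg (D 0 0); have := sq_nonneg (D 1 1); have := sq_nonneg (D 2 2)
  have h0 : D 0 0 = 0 := pow_eq_zero_iff two_ne_zero |>.1 (by linarith)
  have h1 : D 1 1 = 0 := pow_eq_zero_iff two_ne_zero |>.1 (by linarith)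
  have h2 : D 2 2 = 0 := pow_eq_zero_iff two_ne_zero |>.1 (by linarith)
  exact hD (by simp [h0, h1, h2])

lemma exists_ricciMinor_pos_of_rank_one {l : Fin 3 → ℝ} {D : Matrix (Fin 3) (Fin 3) ℝ}
    (h : IsUnimodularDerivation l D) (hD : D 0 0 + D 1 1 + D 2 2 ≠ 0)
    (h0 : l 0 ≠ 0) (h1 : l 1 = 0) (h2 : l 2 = 0) : ∃ i, 0 < ricciMinor l D i := by
  have e0 : D 0 0 = D 1 1 + D 2 2 := mul_left_cancel₀ h0 (h.diag 0)
  have e10 : D 1 0 = 0 := by simpa [h1, h0] using h.offDiag 0 1 (by decide)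
  have e20 : D 2 0 = 0 := by simpa [h2, h0] using h.offDiag 0 2 (by decide)
  have hs := strain_pos hD
  have hd : 0 < (D 1 1 + D 2 2) ^ 2 := by
    have : D 1 1 + D 2 2 ≠ 0 := fun h ↦ hD (by rw [e0, h]; linarith)
    positivity
  have hsum : ricciMinor l D 1 + ricciMinor l D 2 =
      (D 0 0 ^ 2 + D 1 1 ^ 2 + D 2 2 ^ 2 + (D 1 2 + D 2 1) ^ 2 / 2) *
        (l 0 ^ 2 + (D 0 1 ^ 2 + D 0 2 ^ 2) / 2 + 2 * (D 1 1 + D 2 2) ^ 2) +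
      (D 0 1 ^ 2 + D 0 2 ^ 2) / 2 *
        (l 0 ^ 2 / 2 + (D 0 1 ^ 2 + D 0 2 ^ 2) / 2 + 2 * (D 1 1 + D 2 2) ^ 2) := by
    simp only [ricciMinor_eq]
    simp [e10, e20, e0, h1, h2]
    ring
  have hpos : 0 < ricciMinor l D 1 + ricciMinor l D 2 := by rw [hsum]; positivity
  by_contra! hall
  linarith [hall 1, hall 2]

lemma exists_ricciMinor_pos_of_rank_zero {l : Fin 3 → ℝ} {D : Matrix (Fin 3) (Fin 3) ℝ}
    (hD : D 0 0 + D 1 1 + D 2 2 ≠ 0)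
    (h0 : l 0 = 0) (h1 : l 1 = 0) (h2 : l 2 = 0) : ∃ i, 0 < ricciMinor l D i := by
  have hs := strain_pos hD
  have hd : 0 < (D 0 0 + D 1 1 + D 2 2) ^ 2 := by positivity
  have hsum : ricciMinor l D 0 + ricciMinor l D 1 + ricciMinor l D 2 =
      (D 0 0 ^ 2 + D 1 1 ^ 2 + D 2 2 ^ 2 +
      ((D 0 1 + D 1 0) ^ 2 + (D 0 2 + D 2 0) ^ 2 + (D 1 2 + D 2 1) ^ 2) / 2) *
        (D 0 0 + D 1 1 + D 2 2) ^ 2 := by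
    simp only [ricciMinor_eq]
    simp [h0, h1, h2]
    ring
  have hpos : 0 < ricciMinor l D 0 + ricciMinor l D 1 + ricciMinor l D 2 := by
    rw [hsum]; positivity
  by_contra! hall
  linarith [hall 0, hall 1, hall 2]

lemma exists_ricciMinor_pos {l : Fin 3 → ℝ} {D : Matrix (Fin 3) (Fin 3) ℝ}
    (h : IsUnimodularDerivation l D) (hD : D 0 0 + D 1 1 + D 2 2 ≠ 0) :
    ∃ i, 0 < ricciMinor l D i := by
  have rot (k : Fin 3) (hk : ∃ i, 0 < ricciMinor (fun i ↦ l (i + k))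
      (D.submatrix (· + k) (· + k)) i) : ∃ i, 0 < ricciMinor l D i := by
    obtain ⟨i, hi⟩ := hk
    exact ⟨i + k, by rwa [← ricciMinor_rotate]⟩
  have hD1 : D 1 1 + D 2 2 + D 0 0 ≠ 0 := by convert hD using 1; ring
  have hD2 : D 2 2 + D 0 0 + D 1 1 ≠ 0 := by convert hD using 1; ring
  by_cases h0 : l 0 = 0 <;> by_cases h1 : l 1 = 0 <;> by_cases h2 : l 2 = 0
  · exact exists_ricciMinor_pos_of_rank_zero hD h0 h1 h2
  · exact rot 2 (exists_ricciMinor_pos_of_rank_one (h.rotate 2) hD2 h2 h0 h1)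
  · exact rot 1 (exists_ricciMinor_pos_of_rank_one (h.rotate 1) hD1 h1 h2 h0)
  · exact rot 1 (exists_ricciMinor_pos_of_rank_two (h.rotate 1) hD1 h1 h2 h0)
  · exact exists_ricciMinor_pos_of_rank_one h hD h0 h1 h2
  · exact rot 2 (exists_ricciMinor_pos_of_rank_two (h.rotate 2) hD2 h2 h0 h1)
  · exact exists_ricciMinor_pos_of_rank_two h hD h0 h1 h2
  · have e0 : D 0 0 = D 1 1 + D 2 2 := mul_left_cancel₀ h0 (h.diag 0)
    have e1 : D 1 1 = D 2 2 + D 0 0 := mul_left_cancel₀ h1 (h.diag 1)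
    have e2 : D 2 2 = D 0 0 + D 1 1 := mul_left_cancel₀ h2 (h.diag 2)
    exact absurd (by linarith) hD

/-- The Ricci matrix of a four-dimensional non-unimodular metric Lie algebra has at least two
negative eigenvalues. -/
theorem two_le_countP_ricciMatrix_extensionConstants {l : Fin 3 → ℝ}
    {D : Matrix (Fin 3) (Fin 3) ℝ} (h : IsUnimodularDerivation l D)
    (hD : D 0 0 + D 1 1 + D 2 2 ≠ 0) :
    2 ≤ (ricciMatrix (extensionConstants l D)).charpoly.roots.countP (· < 0) := by
  obtain ⟨i, hi⟩ := exists_ricciMinor_pos h hD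
  refine two_le_countP_roots_charpoly (ricciMatrix_extensionConstants_isSymm l D) 0 i.succ ?_ hi
  have hs := strain_pos hD
  rw [ricciMatrix_extensionConstants_zero_zero, neg_lt_zero]
  positivity

open scoped InnerProductSpace

section NormalForm

variable {V : Type*} [NormedAddCommGroup V] [InnerProductSpace ℝ V]

/-- In a four-dimensional non-unimodular metric Lie algebra, there is an orthonormal basis whose
last three vectors span the unimodular kernel and diagonalize its bracket. -/
lemma exists_orthonormalBasis_diagonalizing (hV : Module.finrank ℝ V = 4)
    (β : V →ₗ[ℝ] V →ₗ[ℝ] V) (hskew : ∀ x y, β x y = -β y x)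
    (htr : ∃ x, LinearMap.trace ℝ V (β x) ≠ 0)
    (hβ : ∀ x y, LinearMap.trace ℝ V (β (β x y)) = 0) :
    ∃ e : OrthonormalBasis (Fin 4) ℝ V,
      (∀ i : Fin 3, LinearMap.trace ℝ V (β (e i.succ)) = 0) ∧
      ∀ i j : Fin 3, ⟪e i.succ, β (e i.succ) (e j.succ)⟫_ℝ = 0 := by
  have : FiniteDimensional ℝ V := Module.finite_of_finrank_eq_succ hV
  let τ : V →ₗ[ℝ] ℝ := LinearMap.trace ℝ V ∘ₗ β
  let n : V := (InnerProductSpace.toDual ℝ V).symm (LinearMap.toContinuousLinearMap τ)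
  have hτ (x : V) : LinearMap.trace ℝ V (β x) = ⟪n, x⟫_ℝ := by
    simp [n, τ]
  have hn : n ≠ 0 := by
    rintro h
    obtain ⟨x, hx⟩ := htr
    exact hx (by rw [hτ, h, inner_zero_left])
  have hn' : ‖n‖ ≠ 0 := norm_ne_zero_iff.2 hn
  obtain ⟨f, hf⟩ := Orthonormal.exists_orthonormalBasis_extension_of_card_eq
    (v := fun _ : Fin 4 ↦ (‖n‖⁻¹ • n)) (s := {0}) (𝕜 := ℝ) (by simp [hV]) (by
      refine ⟨fun i ↦ ?_, fun i j hij ↦ absurd (Subsingleton.elim i j) hij⟩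
      simp [norm_smul, hn'])
  have hf0 : n = ‖n‖ • f 0 := by
    rw [hf 0 rfl, smul_smul, mul_inv_cancel₀ hn', one_smul]
  have hfτ (x : V) : LinearMap.trace ℝ V (β x) = ‖n‖ * ⟪f 0, x⟫_ℝ := by
    rw [hτ]; conv_lhs => rw [hf0, real_inner_smul_left]
  have hfi (i j : Fin 4) : ⟪f i, f j⟫_ℝ = if i = j then 1 else 0 :=
    orthonormal_iff_ite.1 f.orthonormal i j
  have hβ0 (x y : V) : ⟪f 0, β x y⟫_ℝ = 0 := by
    have := hβ x y
    rw [hfτ] at this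
    exact (mul_eq_zero.1 this).resolve_left hn'
  have hself (x : V) : β x x = 0 := by
    have h2 : (2 : ℝ) • β x x = 0 := by
      rw [two_smul]; nth_rewrite 1 [hskew]; exact neg_add_cancel _
    exact (smul_eq_zero.1 h2).resolve_left two_ne_zero
  let c (i j k : Fin 3) : ℝ := ⟪f k.succ, β (f i.succ) (f j.succ)⟫_ℝ
  have c_skew (i j k : Fin 3) : c i j k = -c j i k := by
    simp only [c]; rw [hskew, inner_neg_right]
  have c_self (i k : Fin 3) : c i i k = 0 := by simp [c, hself]
  have c_trace (i : Fin 3) : c i 0 0 + c i 1 1 + c i 2 2 = 0 := by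
    have h := hfτ (f i.succ)
    rw [hfi, if_neg (Fin.succ_ne_zero i).symm, mul_zero, LinearMap.trace_eq_sum_inner _ f,
      Fin.sum_univ_succ, hβ0, zero_add, Fin.sum_univ_three] at h
    exact h
  let M : Matrix (Fin 3) (Fin 3) ℝ := fun k m ↦ c (k + 1) (k + 2) m
  have hM : M.IsHermitian := by
    have h01 : M 0 1 = M 1 0 := by
      change c 1 2 1 = c 2 0 0
      linarith [c_skew 1 2 1, c_trace 2, c_self 2 2]
    have h02 : M 0 2 = M 2 0 := by
      change c 1 2 2 = c 0 1 0
      linarith [c_skew 0 1 0, c_trace 1, c_self 1 1]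
    have h12 : M 1 2 = M 2 1 := by
      change c 2 0 2 = c 0 1 1
      linarith [c_skew 2 0 2, c_trace 0, c_self 0 0]
    rw [Matrix.IsHermitian, Matrix.conjTranspose_eq_transpose_of_trivial]
    ext i j
    fin_cases i <;> fin_cases j <;> first | rfl | assumption | (symm; assumption)
  let P := hM.eigenvectorBasis
  let e' : Fin 4 → V := Fin.cons (f 0) fun k ↦ ∑ a, P k a • f a.succ
  have hPP (i j : Fin 3) : ∑ a, P i a * P j a = if i = j then 1 else 0 := by
    rw [← orthonormal_iff_ite.1 P.orthonormal i j, PiLp.inner_apply]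
    simp [mul_comm]
  have he' : Orthonormal ℝ e' := by
    rw [orthonormal_iff_ite]
    intro i j
    refine Fin.cases ?_ (fun i ↦ ?_) i <;> refine Fin.cases ?_ (fun j ↦ ?_) j
    · simp [e']
    · simp [e', inner_sum, real_inner_smul_right, hfi, (Fin.succ_ne_zero _).symm]
    · simp [e', sum_inner, real_inner_smul_left, hfi, Fin.succ_ne_zero]
    · simp [e', sum_inner, inner_sum, real_inner_smul_left, real_inner_smul_right, hfi, hPP, eq_comm]
  obtain ⟨e, he⟩ := Orthonormal.exists_orthonormalBasis_extension_of_card_eq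
    (v := e') (s := Set.univ) (by simp [hV]) (he'.comp _ Subtype.val_injective)
  have hes (k : Fin 3) : e k.succ = ∑ a, P k a • f a.succ := by
    rw [he _ (Set.mem_univ _)]; simp [e']
  refine ⟨e, fun i ↦ ?_, fun i j ↦ ?_⟩
  · rw [hfτ, hes]
    simp [inner_sum, real_inner_smul_right, hfi, (Fin.succ_ne_zero _).symm]
  · have hsum : ⟪e i.succ, β (e i.succ) (e j.succ)⟫_ℝ =
        ∑ a, ∑ a'', P j a * ∑ a', P i a' * (P i a'' * c a' a a'') := by
      rw [hes, hes]
      simp only [map_sum, map_smul, LinearMap.sum_apply, LinearMap.smul_apply, inner_sum, sum_inner,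
        real_inner_smul_left, real_inner_smul_right]
      rfl
    have hev (k : Fin 3) : ∑ m, M k m * P i m = hM.eigenvalues i * P i k :=
      congr_fun (hM.mulVec_eigenvectorBasis i) k
    have hev0 := hev 0
    have hev1 := hev 1
    have hev2 := hev 2
    simp only [Fin.sum_univ_three] at hev0 hev1 hev2 hsum
    rw [hsum]
    simp only [c_self, c_skew 1 0, c_skew 2 1, c_skew 0 2]
    change c 1 2 0 * _ + c 1 2 1 * _ + c 1 2 2 * _ = _ at hev0
    change c 2 0 0 * _ + c 2 0 1 * _ + c 2 0 2 * _ = _ at hev1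
    change c 0 1 0 * _ + c 0 1 1 * _ + c 0 1 2 * _ = _ at hev2
    linear_combination (P i 1 * P j 2 - P i 2 * P j 1) * hev0 +
      (P i 2 * P j 0 - P i 0 * P j 2) * hev1 + (P i 0 * P j 1 - P i 1 * P j 0) * hev2

end NormalForm

lemma eq_extensionConstants {c : Fin 4 → Fin 4 → Fin 4 → ℝ} (hskew : ∀ i j k, c i j k = -c j i k)
    (hzero : ∀ i j, c i j 0 = 0) (hrep : ∀ i j : Fin 3, c i.succ j.succ i.succ = 0) :
    c = extensionConstants (fun i ↦ c (i + 1).succ (i + 2).succ i.succ)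
      (fun i j ↦ c 0 j.succ i.succ) := by
  have hself (i k) : c i i k = 0 := self_eq_neg.1 (hskew i i k)
  have hrep' (i j : Fin 3) : c i.succ j.succ j.succ = 0 := by rw [hskew, hrep, neg_zero]
  funext i j k
  fin_cases i <;> fin_cases j <;> fin_cases k <;> first
    | rfl | exact hself _ _ | exact hzero _ _ | exact hskew _ _ _
    | exact hrep 0 1 | exact hrep 0 2 | exact hrep 1 0 | exact hrep 1 2 | exact hrep 2 0
    | exact hrep 2 1 | exact hrep' 0 1 | exact hrep' 0 2 | exact hrep' 1 0 | exact hrep' 1 2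
    | exact hrep' 2 0 | exact hrep' 2 1

lemma isUnimodularDerivation_of_jacobi {l : Fin 3 → ℝ} {D : Matrix (Fin 3) (Fin 3) ℝ}
    (h : ∀ i j k, ∑ m, extensionConstants l D i j m * extensionConstants l D 0 m k =
      ∑ m, (extensionConstants l D 0 i m * extensionConstants l D m j k +
        extensionConstants l D 0 j m * extensionConstants l D i m k)) :
    IsUnimodularDerivation l D where
  diag i := by
    have h1 := h (i + 1).succ (i + 2).succ i.succ
    fin_cases i <;>
    · simp [extensionConstants, Fin.sum_univ_four] at h1
      simp [mul_add, -mul_eq_mul_left_iff]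
      linarith
  offDiag i j hij := by
    have h1 := h (j + 1).succ (j + 2).succ i.succ
    fin_cases i <;> fin_cases j <;> first
    | exact absurd rfl hij
    | simp [extensionConstants, Fin.sum_univ_four] at h1 ⊢
      linarith

lemma structureConstants_jacobi {ι L : Type*} [Fintype ι] [LieRing L] [LieAlgebra ℝ L]
    (b : Module.Basis ι ℝ L) (a i j k : ι) :
    ∑ m, structureConstants b i j m * structureConstants b a m k =
      ∑ m, (structureConstants b a i m * structureConstants b m j k +
        structureConstants b a j m * structureConstants b i m k) := by
  have hlie (i j : ι) : ⁅b i, b j⁆ = ∑ m, structureConstants b i j m • b m :=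
    (b.sum_repr _).symm
  have h := congrArg (fun x ↦ b.repr x k) (leibniz_lie (b a) (b i) (b j))
  rw [hlie i j, hlie a i, hlie a j] at h
  simpa only [structureConstants, lie_sum, sum_lie, lie_smul, smul_lie, map_add, map_sum, map_smul, Finsupp.add_apply,
    Finsupp.finsetSum_apply, Finsupp.smul_apply, smul_eq_mul, ← Finset.sum_add_distrib] using h

lemma trace_ad_lie {L : Type*} [LieRing L] [LieAlgebra ℝ L] (x y : L) :
    LinearMap.trace ℝ L (LieAlgebra.ad ℝ L ⁅x, y⁆) = 0 := by
  have h : LieAlgebra.ad ℝ L ⁅x, y⁆ =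
      LieAlgebra.ad ℝ L x * LieAlgebra.ad ℝ L y - LieAlgebra.ad ℝ L y * LieAlgebra.ad ℝ L x := by
    ext z
    simp only [LieAlgebra.ad_apply, lie_lie, LinearMap.sub_apply, Module.End.mul_apply]
  rw [h, map_sub, LinearMap.trace_mul_comm, sub_self]

/-- The adjoint representation as a linear map. -/
def adLinear (L : Type*) [LieRing L] [LieAlgebra ℝ L] : L →ₗ[ℝ] L →ₗ[ℝ] L where
  toFun x := LieAlgebra.ad ℝ L x
  map_add' x y := by ext; simp
  map_smul' r x := by ext; simp

theorem exists_basis_structureConstants_eq {L : Type*} [LieRing L] [LieAlgebra ℝ L]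
    (hL : Module.finrank ℝ L = 4) (h : L →ₗ[ℝ] L →ₗ[ℝ] ℝ) (hsymm : ∀ x y, h x y = h y x)
    (hpos : ∀ x, x ≠ 0 → 0 < h x x)
    (htr : ∃ x, LinearMap.trace ℝ L (LieAlgebra.ad ℝ L x) ≠ 0) :
    ∃ (b : Module.Basis (Fin 4) ℝ L) (l : Fin 3 → ℝ) (D : Matrix (Fin 3) (Fin 3) ℝ),
      (∀ i j, h (b i) (b j) = if i = j then 1 else 0) ∧
      structureConstants b = extensionConstants l D ∧
      IsUnimodularDerivation l D ∧ D 0 0 + D 1 1 + D 2 2 ≠ 0 := by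
  let core : InnerProductSpace.Core ℝ L :=
    { inner := fun x y ↦ h x y
      conj_inner_symm := fun x y ↦ hsymm y x
      re_inner_nonneg := fun x ↦ by
        by_cases hx : x = 0
        · simp [hx]
        · exact (hpos x hx).le
      add_left := fun x y z ↦ by simp
      smul_left := fun x y r ↦ by simp
      definite := fun x hx ↦ by
        by_contra hne
        exact (hpos x hne).ne' hx }
  let _ : NormedAddCommGroup L := core.toNormedAddCommGroup
  let _ : InnerProductSpace ℝ L := InnerProductSpace.ofCore core.toCore
  obtain ⟨e, he, hrep⟩ := exists_orthonormalBasis_diagonalizing hL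
    (adLinear L) (fun x y ↦ (lie_skew x y).symm) htr trace_ad_lie
  have hsc (i j k) : structureConstants e.toBasis i j k = ⟪e k, ⁅e i, e j⁆⟫_ℝ := by
    rw [structureConstants, OrthonormalBasis.coe_toBasis, OrthonormalBasis.coe_toBasis_repr_apply,
      OrthonormalBasis.repr_apply_apply]
  have htrace (x : L) : LinearMap.trace ℝ L (LieAlgebra.ad ℝ L x) =
      ⟪e 0, x⟫_ℝ * LinearMap.trace ℝ L (LieAlgebra.ad ℝ L (e 0)) := by
    change LinearMap.trace ℝ L (adLinear L x) = _ * LinearMap.trace ℝ L (adLinear L (e 0))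
    conv_lhs => rw [← e.sum_repr' x]
    rw [map_sum, map_sum, Fin.sum_univ_succ, Finset.sum_eq_zero, add_zero]
    · rw [map_smul, map_smul, smul_eq_mul]
    · intro i _
      rw [map_smul, map_smul]
      exact (congrArg _ (he i)).trans (smul_zero _)
  have htr0 : LinearMap.trace ℝ L (LieAlgebra.ad ℝ L (e 0)) ≠ 0 := by
    intro h0
    obtain ⟨x, hx⟩ := htr
    exact hx (by rw [htrace, h0, mul_zero])
  have hzero (i j) : structureConstants e.toBasis i j 0 = 0 := by
    have := trace_ad_lie (e i) (e j)
    rw [htrace] at this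
    rw [hsc]
    exact (mul_eq_zero.1 this).resolve_right htr0
  have hc := eq_extensionConstants (structureConstants_skew e.toBasis) hzero
    (fun i j ↦ (hsc _ _ _).trans (hrep i j))
  refine ⟨e.toBasis, _, _, fun i j ↦ ?_, hc, isUnimodularDerivation_of_jacobi fun i j k ↦ ?_, ?_⟩
  · rw [OrthonormalBasis.coe_toBasis]
    exact orthonormal_iff_ite.1 e.orthonormal i j
  · rw [← hc]
    exact structureConstants_jacobi _ _ _ _ _
  · rw [LinearMap.trace_eq_sum_inner _ e, Fin.sum_univ_succ, Fin.sum_univ_three] at htr0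
    simp only [LieAlgebra.ad_apply, ← hsc, hzero, zero_add] at htr0
    exact htr0

theorem two_le_countP_eigenvalues_ricciOperator {G : Type*} [TopologicalSpace G]
    [ChartedSpace (EuclideanSpace ℝ (Fin 4)) G] [Group G] [LieGroup (𝓡 4) ∞ G]
    (hG : ¬ IsUnimodular (𝓡 4) G) {g : Metric (𝓡 4) G} (hg : IsLeftInvariant g) (p : G) :
    2 ≤ (eigenvalues (ricciOperator g p)).countP (· < 0) := by
  obtain ⟨b, l, D, hb, hc, hD, htr⟩ := exists_basis_structureConstants_eq
    (L := GroupLieAlgebra (𝓡 4) G) (finrank_euclideanSpace_fin (𝕜 := ℝ) (n := 4))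
    ((ContinuousLinearMap.coeLM ℝ).comp (g.inner 1).toLinearMap) (g.symm 1) (g.pos 1)
    (by simpa [IsUnimodular] using hG)
  rw [eigenvalues_ricciOperator (b := b) hb hg, hc]
  exact two_le_countP_ricciMatrix_extensionConstants hD htr

section DiagonalGroup

/-- The Euclidean space `ℝ⁴`. -/
local notation "E4" => EuclideanSpace ℝ (Fin 4)

/-- The standard charted space structure on `ℝ⁴`. -/
local instance euclideanChartedSpace : ChartedSpace E4 E4 := chartedSpaceSelf E4

variable (a : Fin 3 → ℝ)

/-- The weights of the action of `ℝ` on `ℝ × ℝ³`. -/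
def weight : Fin 4 → ℝ := Fin.cons 0 a

@[simp] lemma weight_zero : weight a 0 = 0 := rfl

/-- The diagonal action of the first coordinate. -/
def dilation (t : ℝ) : E4 →L[ℝ] E4 :=
  LinearMap.toContinuousLinearMap
    { toFun := fun v ↦ WithLp.toLp 2 fun i ↦ Real.exp (weight a i * t) * v i
      map_add' := fun v w ↦ by ext; simp [mul_add]
      map_smul' := fun r v ↦ by ext; simp [mul_left_comm] }

@[simp] lemma dilation_apply (t : ℝ) (v : E4) (i : Fin 4) :
    dilation a t v i = Real.exp (weight a i * t) * v i := rfl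

/-- The semidirect product of `ℝ` and `ℝ³`, where `t : ℝ` acts by the diagonal matrix with
entries `exp (a i * t)`. -/
abbrev diagonalGroup : Group E4 where
  mul p q := p + dilation a (p 0) q
  one := 0
  inv p := -dilation a (-p 0) p
  mul_assoc p q r := by
    ext i
    change p i + Real.exp (weight a i * p 0) * q i +
      Real.exp (weight a i * (p 0 + Real.exp (weight a 0 * p 0) * q 0)) * r i =
      p i + Real.exp (weight a i * p 0) * (q i + Real.exp (weight a i * q 0) * r i)
    rw [weight_zero, zero_mul, Real.exp_zero, one_mul, mul_add (weight a i), Real.exp_add]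
    ring
  one_mul p := by
    ext i
    change (0 : ℝ) + Real.exp (weight a i * 0) * p i = p i
    simp
  mul_one p := by
    ext i
    change p i + Real.exp (weight a i * p 0) * 0 = p i
    simp
  inv_mul_cancel p := by
    ext i
    change -(Real.exp (weight a i * -p 0) * p i) +
      Real.exp (weight a i * -(Real.exp (weight a 0 * -p 0) * p 0)) * p i = 0
    simp

lemma contDiff_dilation : ContDiff ℝ ∞ fun p : E4 × E4 ↦ dilation a (p.1 0) p.2 := by
  rw [contDiff_euclidean]
  intro i
  simp only [dilation_apply]
  fun_prop

lemma lieGroup_diagonalGroup : letI := diagonalGroup a; LieGroup (𝓡 4) ∞ E4 := by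
  let _ := diagonalGroup a
  exact
    { contMDiff_mul := by
        have : ContDiff ℝ ∞ fun p : E4 × E4 ↦ p.1 + dilation a (p.1 0) p.2 :=
          contDiff_fst.add (contDiff_dilation a)
        have := this.contMDiff
        rwa [modelWithCornersSelf_prod, ← chartedSpaceSelf_prod] at this
      contMDiff_inv := by
        have h : ContDiff ℝ ∞ fun p : E4 ↦ (-p, p) := contDiff_neg.prodMk contDiff_id
        have : ContDiff ℝ ∞ fun p : E4 ↦ -dilation a (-p 0) p :=
          ((contDiff_dilation a).comp h).neg
        exact this.contMDiff }

lemma hasFDerivAt_diagonalGroup_mul (p q : E4) :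
    HasFDerivAt (fun r : E4 ↦ (letI := diagonalGroup a; p * r)) (dilation a (p 0)) q :=
  (dilation a (p 0)).hasFDerivAt.const_add p

lemma mfderiv_diagonalGroup_mul (p q : E4) :
    mfderiv (𝓡 4) (𝓡 4) (fun r : E4 ↦ (letI := diagonalGroup a; p * r)) q =
      dilation a (p 0) := by
  rw [mfderiv_eq_fderiv]
  exact (hasFDerivAt_diagonalGroup_mul a p q).fderiv

lemma mulInvariantVectorField_diagonalGroup (v : E4) :
    letI := diagonalGroup a
    (mulInvariantVectorField (I := 𝓡 4) (G := E4) v : E4 → E4) = fun p ↦ dilation a (p 0) v :=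
  funext fun p ↦ DFunLike.congr_fun (mfderiv_diagonalGroup_mul a p 0) v

/-- The derivative at the identity of a left-invariant vector field on the diagonal group. -/
def dilationDeriv (v : E4) : E4 →L[ℝ] E4 :=
  LinearMap.toContinuousLinearMap
    { toFun := fun u ↦ WithLp.toLp 2 fun i ↦ weight a i * u 0 * v i
      map_add' := fun u w ↦ PiLp.ext fun i ↦ by
        change weight a i * (u 0 + w 0) * v i = weight a i * u 0 * v i + weight a i * w 0 * v i
        ring
      map_smul' := fun r u ↦ PiLp.ext fun i ↦ by
        change weight a i * (r * u 0) * v i = r * (weight a i * u 0 * v i)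
        ring }

lemma hasFDerivAt_dilation (v : E4) :
    HasFDerivAt (fun p : E4 ↦ dilation a (p 0) v) (dilationDeriv a v) 0 := by
  rw [← hasFDerivWithinAt_univ]
  refine hasFDerivWithinAt_euclidean.2 fun i ↦ ?_
  have h0 : HasFDerivAt (fun p : E4 ↦ p 0) (EuclideanSpace.proj 0 : E4 →L[ℝ] ℝ) 0 :=
    (EuclideanSpace.proj 0 : E4 →L[ℝ] ℝ).hasFDerivAt
  have h := ((h0.const_mul (weight a i)).exp).mul_const (v i)
  refine (h.congr_fderiv ?_).hasFDerivWithinAt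
  ext u
  change v i * (Real.exp (weight a i * 0) * (weight a i * u 0)) = weight a i * u 0 * v i
  rw [mul_zero, Real.exp_zero]
  ring

lemma lieBracket_dilation (v w : E4) (i : Fin 4) :
    VectorField.lieBracket ℝ (fun p : E4 ↦ dilation a (p 0) v) (fun p : E4 ↦ dilation a (p 0) w)
      0 i = weight a i * (v 0 * w i - w 0 * v i) := by
  rw [VectorField.lieBracket, (hasFDerivAt_dilation a v).fderiv, (hasFDerivAt_dilation a w).fderiv]
  change weight a i * (Real.exp (weight a 0 * 0) * v 0) * w i -
    weight a i * (Real.exp (weight a 0 * 0) * w 0) * v i = _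
  rw [mul_zero, Real.exp_zero]
  ring

/-- The Lie bracket on the tangent space at the identity of the diagonal group. -/
def diagonalBracket (v w : E4) : E4 :=
  letI := diagonalGroup a
  (Bracket.bracket (L := GroupLieAlgebra (𝓡 4) E4) (M := GroupLieAlgebra (𝓡 4) E4) v w)

lemma diagonalBracket_apply (v w : E4) (i : Fin 4) :
    diagonalBracket a v w i = weight a i * (v 0 * w i - w 0 * v i) := by
  rw [← lieBracket_dilation]
  let _ := diagonalGroup a
  have key : VectorField.mlieBracket (𝓡 4) (mulInvariantVectorField (I := 𝓡 4) (G := E4) v)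
      (mulInvariantVectorField (I := 𝓡 4) (G := E4) w) (0 : E4) = VectorField.lieBracket ℝ
      (fun p : E4 ↦ dilation a (p 0) v) (fun p : E4 ↦ dilation a (p 0) w) 0 := by
    rw [← VectorField.mlieBracketWithin_univ, VectorField.mlieBracketWithin_eq_lieBracketWithin,
      ← VectorField.lieBracketWithin_univ]
    erw [mulInvariantVectorField_diagonalGroup, mulInvariantVectorField_diagonalGroup]
  exact congrArg (fun x : E4 ↦ x i) key

/-- The left-invariant inner products on the diagonal group which extend the standard one. -/
def diagonalInner (p : E4) : E4 →L[ℝ] E4 →L[ℝ] ℝ :=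
  ∑ i, Real.exp (-2 * weight a i * p 0) •
    (EuclideanSpace.proj i : E4 →L[ℝ] ℝ).smulRight (EuclideanSpace.proj i : E4 →L[ℝ] ℝ)

lemma diagonalInner_apply (p v w : E4) :
    diagonalInner a p v w = ∑ i, Real.exp (-2 * weight a i * p 0) * (v i * w i) := by
  simp [diagonalInner]

lemma contDiff_smul_const_right {X F : Type*} [NormedAddCommGroup X] [NormedSpace ℝ X]
    [NormedAddCommGroup F] [NormedSpace ℝ F] {f : X → ℝ} {n : ℕ∞ω} (hf : ContDiff ℝ n f) (c : F) :
    ContDiff ℝ n fun x ↦ f x • c := hf.smul contDiff_const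

lemma contDiff_diagonalInner : ContDiff ℝ ∞ (diagonalInner a) := by
  refine ContDiff.sum fun i _ ↦ ?_
  have h : ContDiff ℝ ∞ fun p : E4 ↦ Real.exp (-2 * weight a i * p 0) := by fun_prop
  exact contDiff_smul_const_right h _

lemma sq_norm_le_of_diagonalInner_lt_one (p v : E4) (h : diagonalInner a p v v < 1) :
    ‖v‖ ^ 2 ≤ ∑ i, Real.exp (2 * weight a i * p 0) := by
  rw [EuclideanSpace.norm_sq_eq]
  refine Finset.sum_le_sum fun i _ ↦ ?_
  have h1 : Real.exp (-2 * weight a i * p 0) * (v i * v i) ≤ 1 := by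
    refine le_trans ?_ h.le
    rw [diagonalInner_apply]
    exact Finset.single_le_sum (f := fun i ↦ Real.exp (-2 * weight a i * p 0) * (v i * v i))
      (fun i _ ↦ mul_nonneg (Real.exp_pos _).le (mul_self_nonneg _)) (Finset.mem_univ i)
  have h2 : Real.exp (2 * weight a i * p 0) * Real.exp (-2 * weight a i * p 0) = 1 := by
    rw [← Real.exp_add]; ring_nf; exact Real.exp_zero
  have h3 := mul_le_mul_of_nonneg_left h1 (Real.exp_pos (2 * weight a i * p 0)).le
  rw [← mul_assoc, h2, one_mul, mul_one] at h3
  rwa [Real.norm_eq_abs, sq_abs, sq]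

/-- The left-invariant metric on the diagonal group which extends the standard inner product. -/
def diagonalMetric :
    Bundle.ContMDiffRiemannianMetric (𝓡 4) ∞ E4 (fun p : E4 ↦ TangentSpace (𝓡 4) p) where
  inner p := diagonalInner a p
  symm p v w := by
    refine (diagonalInner_apply a p v w).trans (Eq.trans ?_ (diagonalInner_apply a p w v).symm)
    exact Finset.sum_congr rfl fun i _ ↦ congrArg _ (mul_comm _ _)
  pos p v hv := by
    refine lt_of_lt_of_eq ?_ (diagonalInner_apply a p v v).symm
    obtain ⟨i, hi⟩ : ∃ i, WithLp.ofLp (p := 2) (V := Fin 4 → ℝ) v i ≠ 0 := by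
      by_contra! h
      exact hv (PiLp.ext (p := 2) (α := fun _ : Fin 4 ↦ ℝ) (x := v) (y := 0) h)
    exact Finset.sum_pos' (fun i _ ↦ mul_nonneg (Real.exp_pos _).le (mul_self_nonneg _))
      ⟨i, Finset.mem_univ i, mul_pos (Real.exp_pos _) (mul_self_pos.2 hi)⟩
  isVonNBounded p := by
    change Bornology.IsVonNBounded ℝ {v : E4 | diagonalInner a p v v < 1}
    rw [NormedSpace.isVonNBounded_iff]
    refine (Metric.isBounded_closedBall (x := (0 : E4))
      (r := √(∑ i, Real.exp (2 * weight a i * p 0)))).subset fun v hv ↦ ?_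
    rw [mem_closedBall_zero_iff]
    exact Real.le_sqrt_of_sq_le (sq_norm_le_of_diagonalInner_lt_one a p v hv)
  contMDiff := by
    intro x
    refine (Bundle.contMDiffAt_section _).2 ?_
    refine (contDiff_diagonalInner a).contMDiff.contMDiffAt.congr_of_eventuallyEq
      (.of_forall fun y ↦ ?_)
    ext v w
    have hy : y ∈ (chartAt E4 x).source := Set.mem_univ y
    simp [hom_trivializationAt_apply, ContinuousLinearMap.inCoordinates]
    rw [Bundle.Trivialization.linearMapAt_apply, if_pos (by simpa using hy),
      hom_trivializationAt_apply]
    simp [ContinuousLinearMap.inCoordinates]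
    rfl

lemma diagonalInner_dilation (q p v w : E4) :
    diagonalInner a (q + dilation a (q 0) p) (dilation a (q 0) v) (dilation a (q 0) w) =
      diagonalInner a p v w := by
  rw [diagonalInner_apply, diagonalInner_apply]
  refine Finset.sum_congr rfl fun i _ ↦ ?_
  have h : Real.exp (-2 * weight a i * (q + dilation a (q 0) p).ofLp 0) =
      Real.exp (-2 * weight a i * p 0) * Real.exp (-(weight a i * q 0)) *
        Real.exp (-(weight a i * q 0)) := by
    rw [← Real.exp_add, ← Real.exp_add]
    congr 1
    change -2 * weight a i * (q 0 + Real.exp (weight a 0 * q 0) * p 0) = _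
    rw [weight_zero, zero_mul, Real.exp_zero]
    ring
  have h2 : Real.exp (-(weight a i * q 0)) * Real.exp (weight a i * q 0) = 1 := by
    rw [← Real.exp_add, neg_add_cancel, Real.exp_zero]
  rw [h, dilation_apply, dilation_apply]
  linear_combination Real.exp (-2 * weight a i * p 0) * v i * w i *
    (Real.exp (-(weight a i * q 0)) * Real.exp (weight a i * q 0) + 1) * h2

lemma isLeftInvariant_diagonalMetric : letI := diagonalGroup a
    haveI := lieGroup_diagonalGroup a
    IsLeftInvariant (I := 𝓡 4) (G := E4) (diagonalMetric a) := by
  let _ := diagonalGroup a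
  have := lieGroup_diagonalGroup a
  intro q p v w
  rw [mfderiv_diagonalGroup_mul]
  exact diagonalInner_dilation a q p v w

/-- The standard basis of the Lie algebra of the diagonal group. -/
def diagonalBasis : letI := diagonalGroup a
    Module.Basis (Fin 4) ℝ (GroupLieAlgebra (𝓡 4) E4) :=
  (EuclideanSpace.basisFun (Fin 4) ℝ).toBasis

lemma isOrthonormalFor_diagonalBasis : letI := diagonalGroup a
    haveI := lieGroup_diagonalGroup a
    IsOrthonormalFor (I := 𝓡 4) (G := E4) (diagonalBasis a) (diagonalMetric a) := by
  let _ := diagonalGroup a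
  have := lieGroup_diagonalGroup a
  intro i j
  have h : diagonalInner a 0 ((EuclideanSpace.basisFun (Fin 4) ℝ).toBasis i)
      ((EuclideanSpace.basisFun (Fin 4) ℝ).toBasis j) = if i = j then 1 else 0 := by
    rw [diagonalInner_apply]
    simp [eq_comm]
  exact h

lemma structureConstants_diagonalBasis : letI := diagonalGroup a
    haveI := lieGroup_diagonalGroup a
    structureConstants (diagonalBasis a) = extensionConstants 0 (Matrix.diagonal a) := by
  let _ := diagonalGroup a
  have := lieGroup_diagonalGroup a
  funext i j k
  have h : structureConstants (diagonalBasis a) i j k =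
      diagonalBracket a ((EuclideanSpace.basisFun (Fin 4) ℝ).toBasis i)
        ((EuclideanSpace.basisFun (Fin 4) ℝ).toBasis j) k := rfl
  rw [h, diagonalBracket_apply]
  fin_cases i <;> fin_cases j <;> fin_cases k <;>
    simp [extensionConstants, weight] <;> rfl

lemma not_isUnimodular_diagonalGroup (ha : a 0 + a 1 + a 2 ≠ 0) : letI := diagonalGroup a
    haveI := lieGroup_diagonalGroup a
    ¬ IsUnimodular (𝓡 4) E4 := by
  let _ := diagonalGroup a
  have := lieGroup_diagonalGroup a
  intro h
  have h1 := h (diagonalBasis a 0)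
  rw [LinearMap.trace_eq_matrix_trace ℝ (diagonalBasis a), Matrix.trace] at h1
  have h2 (i : Fin 4) : Matrix.diag (LinearMap.toMatrix (diagonalBasis a) (diagonalBasis a)
      (LieAlgebra.ad ℝ (GroupLieAlgebra (𝓡 4) E4) (diagonalBasis a 0))) i =
      structureConstants (diagonalBasis a) 0 i i := by
    rw [Matrix.diag_apply, LinearMap.toMatrix_apply]
    rfl
  simp only [h2, structureConstants_diagonalBasis] at h1
  refine ha ?_
  simpa [extensionConstants, Fin.sum_univ_four] using h1

lemma ricciMatrix_extensionConstants_diagonal :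
    ricciMatrix (extensionConstants 0 (Matrix.diagonal a)) =
      Matrix.diagonal ![-(a 0 ^ 2 + a 1 ^ 2 + a 2 ^ 2), -(a 0 + a 1 + a 2) * a 0,
        -(a 0 + a 1 + a 2) * a 1, -(a 0 + a 1 + a 2) * a 2] := by
  ext i j
  fin_cases i <;> fin_cases j <;>
  · simp [ricciMatrix, christoffel, extensionConstants, Fin.sum_univ_four]
    try ring

theorem signature_ricciOperator_diagonalMetric (h0 : (a 0 + a 1 + a 2) * a 0 ≤
      a 0 ^ 2 + a 1 ^ 2 + a 2 ^ 2) (hd : 0 < a 0 + a 1 + a 2) (h1 : a 1 ≤ a 0) (h2 : a 2 ≤ a 1)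
    (p : E4) : letI := diagonalGroup a
    haveI := lieGroup_diagonalGroup a
    signature (ricciOperator (I := 𝓡 4) (G := E4) (diagonalMetric a) p) =
      [-1, -SignType.sign (a 0), -SignType.sign (a 1), -SignType.sign (a 2)] := by
  let _ := diagonalGroup a
  have := lieGroup_diagonalGroup a
  have hroots : eigenvalues (ricciOperator (I := 𝓡 4) (G := E4) (diagonalMetric a) p) =
      (([-(a 0 ^ 2 + a 1 ^ 2 + a 2 ^ 2), -(a 0 + a 1 + a 2) * a 0,
        -(a 0 + a 1 + a 2) * a 1, -(a 0 + a 1 + a 2) * a 2] : List ℝ) : Multiset ℝ) := by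
    rw [eigenvalues_ricciOperator (isOrthonormalFor_diagonalBasis a)
      (isLeftInvariant_diagonalMetric a), structureConstants_diagonalBasis,
      ricciMatrix_extensionConstants_diagonal, Matrix.charpoly_diagonal,
      Polynomial.roots_prod _ _ (Finset.prod_ne_zero_iff.2 fun i _ ↦ Polynomial.X_sub_C_ne_zero _)]
    simp only [Polynomial.roots_X_sub_C]
    rfl
  have hsorted : List.Pairwise (· ≤ ·) [-(a 0 ^ 2 + a 1 ^ 2 + a 2 ^ 2), -(a 0 + a 1 + a 2) * a 0,
        -(a 0 + a 1 + a 2) * a 1, -(a 0 + a 1 + a 2) * a 2] := by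
    have e1 := mul_le_mul_of_nonneg_left h1 hd.le
    have e2 := mul_le_mul_of_nonneg_left h2 hd.le
    simp only [List.pairwise_cons, List.mem_cons, List.not_mem_nil, or_false, forall_eq_or_imp,
      forall_eq]
    refine ⟨⟨?_, ?_, ?_⟩, ⟨?_, ?_⟩, ?_, ?_, ?_⟩ <;> first | linarith | simp
  have hneg : -(a 0 ^ 2 + a 1 ^ 2 + a 2 ^ 2) < 0 := by
    have := strain_pos (D := Matrix.diagonal a) (by simpa using hd.ne')
    rw [neg_lt_zero]
    simpa using this
  have hsign (x : ℝ) : SignType.sign (-(a 0 + a 1 + a 2) * x) = -SignType.sign x := by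
    rw [sign_mul, sign_neg (neg_lt_zero.2 hd), neg_one_mul]
  rw [signature, hroots, Multiset.coe_sort, List.mergeSort_of_pairwise (by simpa using hsorted)]
  simp only [List.map_cons, List.map_nil, hsign, sign_neg hneg]

theorem exists_diagonalGroup (h0 : (a 0 + a 1 + a 2) * a 0 ≤
      a 0 ^ 2 + a 1 ^ 2 + a 2 ^ 2) (hd : 0 < a 0 + a 1 + a 2) (h1 : a 1 ≤ a 0) (h2 : a 2 ≤ a 1) :
    ∃ (G : Type) (_ : TopologicalSpace G) (_ : ChartedSpace (EuclideanSpace ℝ (Fin 4)) G)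
      (_ : Group G) (_ : LieGroup (𝓡 4) ∞ G), ConnectedSpace G ∧ ¬ IsUnimodular (𝓡 4) G ∧
      ∃ g : Metric (𝓡 4) G, IsLeftInvariant g ∧ ∀ p : G, signature (ricciOperator g p) =
        [-1, -SignType.sign (a 0), -SignType.sign (a 1), -SignType.sign (a 2)] :=
  ⟨E4, inferInstance, euclideanChartedSpace, diagonalGroup a, lieGroup_diagonalGroup a,
    inferInstance, not_isUnimodular_diagonalGroup a hd.ne', diagonalMetric a,
    isLeftInvariant_diagonalMetric a, signature_ricciOperator_diagonalMetric a h0 hd h1 h2⟩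

end DiagonalGroup

end LeftInvariantRicci

end

theorem corollary3 :
    (∀ (G : Type*) [TopologicalSpace G] [ChartedSpace (EuclideanSpace ℝ (Fin 4)) G] [Group G]
      [LieGroup (𝓡 4) ∞ G], ¬ LeftInvariantRicci.IsUnimodular (𝓡 4) G →
      ∀ g : LeftInvariantRicci.Metric (𝓡 4) G, LeftInvariantRicci.IsLeftInvariant g →
        ∀ p : G, 2 ≤ (LeftInvariantRicci.eigenvalues
          (LeftInvariantRicci.ricciOperator g p)).countP (· < 0)) ∧
    (∀ s ∈ ([[-1, -1, -1, -1], [-1, -1, -1, 0], [-1, -1, -1, 1],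
          [-1, -1, 0, 0], [-1, -1, 0, 1], [-1, -1, 1, 1]] : List (List SignType)),
      ∃ (G : Type) (_ : TopologicalSpace G) (_ : ChartedSpace (EuclideanSpace ℝ (Fin 4)) G)
        (_ : Group G) (_ : LieGroup (𝓡 4) ∞ G),
        ConnectedSpace G ∧ ¬ LeftInvariantRicci.IsUnimodular (𝓡 4) G ∧
        ∃ g : LeftInvariantRicci.Metric (𝓡 4) G, LeftInvariantRicci.IsLeftInvariant g ∧
          ∀ p : G, LeftInvariantRicci.signature (LeftInvariantRicci.ricciOperator g p) = s) := by
  refine ⟨fun G _ _ _ _ hG g hg p ↦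
    LeftInvariantRicci.two_le_countP_eigenvalues_ricciOperator hG hg p, fun s hs ↦ ?_⟩
  have key (a₁ a₂ a₃ : ℝ) (h0 : (a₁ + a₂ + a₃) * a₁ ≤ a₁ ^ 2 + a₂ ^ 2 + a₃ ^ 2)
      (hd : 0 < a₁ + a₂ + a₃) (h1 : a₂ ≤ a₁) (h2 : a₃ ≤ a₂)
      (hs : s = [-1, -SignType.sign a₁, -SignType.sign a₂, -SignType.sign a₃]) :=
    hs ▸ LeftInvariantRicci.exists_diagonalGroup ![a₁, a₂, a₃] h0 hd h1 h2
  simp only [List.mem_cons, List.not_mem_nil, or_false] at hs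
  obtain rfl | rfl | rfl | rfl | rfl | rfl := hs
  · exact key 1 1 1 (by norm_num) (by norm_num) (by norm_num) (by norm_num) (by simp)
  · exact key 1 1 0 (by norm_num) (by norm_num) (by norm_num) (by norm_num) (by simp)
  · exact key 2 2 (-1) (by norm_num) (by norm_num) (by norm_num) (by norm_num) (by simp)
  · exact key 1 0 0 (by norm_num) (by norm_num) (by norm_num) (by norm_num) (by simp)
  · exact key 2 0 (-1) (by norm_num) (by norm_num) (by norm_num) (by norm_num) (by simp)
  · exact key 3 (-1) (-1) (by norm_num) (by norm_num) (by norm_num) (by norm_num) (by simp)
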